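/- Let $\mathbb{H}=\{(z_1,z_2)\in\mathbb{C}^2 : |z_1|<|z_2|<1\}$ be the Hartogs triangle and $dV$ Lebesgue measure. For a positive continuous function $\mu$ on $\mathbb{H}$ and $1\le p<\infty$ let $L^p(\mathbb{H},\mu)$ be the $L^p$ space of the measure $\mu\,dV$ on $\mathbb{H}$, let $A^2(\mathbb{H},\mu)$ be the closed subspace of $L^2(\mathbb{H},\mu)$ consisting of holomorphic functions, and let the weighted Bergman projection $\mathcal{B}_{\mathbb{H},\mu}$ be the orthogonal projection from $L^2(\mathbb{H},\mu)$ to $A^2(\mathbb{H},\mu)$. It is called $L^p(\mathbb{H},\mu)$ bounded if there is a constant $C<\infty$ with $\|\mathcal{B}_{\mathbb{H},\mu}f\|_{L^p(\mathbb{H},\mu)}\le C\|f\|_{L^p(\mathbb{H},\mu)}$ for all $f\in L^2(\mathbb{H},\mu)\cap L^p(\mathbb{H},\mu)$. Let $p_0\in[1,2)$, let $p_0'\in(2,\infty]$ be its conjugate exponent, $\frac1{p_0}+\frac1{p_0'}=1$ (so $p_0'=\infty$ if $p_0=1$), and let $\mu(z)=|z_2|^{-(p_0+4)}$ for $z\in\mathbb{H}$.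 Then, for $1\le p<\infty$, $\mathcal{B}_{\mathbb{H},\mu}$ is $L^p(\mathbb{H},\mu)$ bounded if and only if $p\in(p_0,p_0')$. In particular, unbounded weights can shrink the range of $p$ arbitrarily: for every $\varepsilon>0$ there is $s\in\mathbb{R}$ such that the weight $\mu(z)=|z_2|^{s}$ is unbounded on $\mathbb{H}$ and every $p\in[1,\infty)$ for which $\mathcal{B}_{\mathbb{H},\mu}$ is $L^p(\mathbb{H},\mu)$ bounded lies in $(2-\varepsilon,2+\varepsilon)$. -/

import Mathlib

open MeasureTheory Set Filter Topology Metric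
open scoped ENNReal NNReal

section General

/-- A locally uniform limit of holomorphic functions is holomorphic. -/
theorem differentiableAt_of_uniformCauchySeqOn {E : Type*} [NormedAddCommGroup E]
    [NormedSpace ℂ E] {F : ℕ → E → ℂ} {f : E → ℂ} {a : E} {r : ℝ}
    (hr : 0 < r) (hF : ∀ n, DifferentiableOn ℂ (F n) (ball a r))
    (hC : UniformCauchySeqOn F atTop (ball a r))
    (hf : ∀ z ∈ ball a r, Tendsto (fun n => F n z) atTop (𝓝 (f z))) :
    DifferentiableAt ℂ f a := by
  have hsub : ball a (r / 2) ⊆ ball a r := ball_subset_ball (by linarith)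
  have hdiff : ∀ n, ∀ z ∈ ball a r, DifferentiableAt ℂ (F n) z := fun n z hz =>
    (hF n).differentiableAt (isOpen_ball.mem_nhds hz)
  have hC' : UniformCauchySeqOn (fun n => fderiv ℂ (F n)) atTop (ball a (r / 2)) := by
    rw [Metric.uniformCauchySeqOn_iff] at hC ⊢
    intro ε hε
    obtain ⟨N, hN⟩ := hC (ε * r / 8) (by positivity)
    refine ⟨N, fun m hm n hn z hz => ?_⟩
    have hzr : ball z (r / 2) ⊆ ball a r := by
      refine ball_subset_ball' ?_
      have := mem_ball.1 hz
      linarith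
    have hb : ∀ w ∈ ball a r, ‖(F m - F n) w‖ ≤ ε * r / 8 := fun w hw => by
      have := (hN m hm n hn w hw).le
      rwa [dist_eq_norm] at this
    have h1 : ‖fderiv ℂ (F m - F n) z‖ ≤ (ε * r / 4) / (r / 2) := by
      refine Complex.norm_fderiv_le_div_of_mapsTo_ball
        (((hF m).sub (hF n)).mono hzr) (fun w hw => ?_) (by positivity)
      rw [mem_closedBall, dist_eq_norm]
      have h3 := norm_sub_le ((F m - F n) w) ((F m - F n) z)
      have h4 := hb w (hzr hw)
      have h5 := hb z (hsub hz)
      linarith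
    rw [fderiv_sub (hdiff m z (hsub hz)) (hdiff n z (hsub hz))] at h1
    rw [dist_eq_norm]
    refine h1.trans_lt ?_
    rw [div_lt_iff₀ (by positivity)]
    nlinarith [mul_pos hε hr]
  have hlim : ∀ z ∈ ball a (r / 2),
      ∃ L, Tendsto (fun n => fderiv ℂ (F n) z) atTop (𝓝 L) := fun z hz =>
    cauchySeq_tendsto_of_complete (hC'.cauchySeq hz)
  choose! g' hg' using hlim
  exact (hasFDerivAt_of_tendstoUniformlyOn isOpen_ball
    (hC'.tendstoUniformlyOn_of_tendsto hg')
    (fun n z hz => (hdiff n z (hsub hz)).hasFDerivAt) (fun z hz => hf z (hsub hz))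
    (mem_ball_self (by positivity))).differentiableAt

variable {E : Type*} [NormedAddCommGroup E] [NormedSpace ℂ E] [MeasureSpace E]

/-- The measure `μ dV` on a domain `Ω`, where `μ` is a nonnegative weight and `dV` is volume. -/
noncomputable def weightedMeasure (Ω : Set E) (μ : E → ℝ) : Measure E :=
  (volume.restrict Ω).withDensity fun z => ENNReal.ofReal (μ z)

/-- The weighted Bergman space `A²(Ω, μ) = L²(Ω, μ) ∩ 𝒪(Ω)`: the classes in `L²(Ω, μ)` that have a
representative which is holomorphic on `Ω`. -/
noncomputable def bergmanSpace (Ω : Set E) (μ : E → ℝ) :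
    Submodule ℂ (Lp ℂ 2 (weightedMeasure Ω μ)) where
  carrier := {F | ∃ f : E → ℂ, DifferentiableOn ℂ f Ω ∧ F =ᵐ[weightedMeasure Ω μ] f}
  zero_mem' := ⟨fun _ => 0, differentiableOn_const _, Lp.coeFn_zero _ _ _⟩
  add_mem' := by
    rintro F G ⟨f, hf, hF⟩ ⟨g, hg, hG⟩
    exact ⟨f + g, hf.add hg, (Lp.coeFn_add F G).trans (hF.add hG)⟩
  smul_mem' := by
    rintro c F ⟨f, hf, hF⟩
    exact ⟨c • f, hf.const_smul c, (Lp.coeFn_smul c F).trans (hF.const_smul c)⟩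

/-- The weighted Bergman projection: the orthogonal projection from `L²(Ω, μ)` to `A²(Ω, μ)`. -/
noncomputable def bergmanProjection (Ω : Set E) (μ : E → ℝ)
    [(bergmanSpace Ω μ).HasOrthogonalProjection] :
    Lp ℂ 2 (weightedMeasure Ω μ) →L[ℂ] Lp ℂ 2 (weightedMeasure Ω μ) :=
  (bergmanSpace Ω μ).starProjection

/-- The weighted Bergman projection is `Lᵖ(Ω, μ)` bounded: on the subspace `L²(Ω, μ) ∩ Lᵖ(Ω, μ)`,
which is dense in `Lᵖ(Ω, μ)` for finite `p`, it is bounded in the `Lᵖ(Ω, μ)` norm. -/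
def BergmanProjectionLpBounded (Ω : Set E) (μ : E → ℝ)
    [(bergmanSpace Ω μ).HasOrthogonalProjection] (p : ℝ) : Prop :=
  ∃ C : ℝ≥0, ∀ f : Lp ℂ 2 (weightedMeasure Ω μ),
    MemLp f (ENNReal.ofReal p) (weightedMeasure Ω μ) →
      eLpNorm (bergmanProjection Ω μ f) (ENNReal.ofReal p) (weightedMeasure Ω μ) ≤
        C * eLpNorm f (ENNReal.ofReal p) (weightedMeasure Ω μ)

theorem ae_mem_of_weightedMeasure {X : Type*} [MeasureSpace X] {Ω : Set X} (hΩ : MeasurableSet Ω) (μ : X → ℝ) :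
    ∀ᵐ z ∂(weightedMeasure Ω μ), z ∈ Ω :=
  (withDensity_absolutelyContinuous _ _).ae_le (ae_restrict_mem hΩ)

variable [BorelSpace E] [FiniteDimensional ℂ E] [(volume : Measure E).IsAddHaarMeasure]

/-- Rotations of a complex vector space preserve volume. -/
theorem lintegral_rotate (a : E) (u : Circle) (h : E → ℝ≥0∞) :
    ∫⁻ v, h (a + (u : ℂ) • v) = ∫⁻ z, h z := by
  have : ProperSpace E := FiniteDimensional.proper ℂ E
  let L : E ≃L[ℂ] E := (LinearEquiv.smulOfNeZero ℂ E (u : ℂ) (Circle.coe_ne_zero u))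
    |>.toContinuousLinearEquiv
  have hL : ∀ v, L v = (u : ℂ) • v := fun v => rfl
  have hpre : L ⁻¹' (ball (0 : E) 1) = ball 0 1 := by
    ext v
    simp [hL, norm_smul, Circle.norm_coe]
  have hmap : (volume : Measure E).map L = volume := by
    have h1 := Measure.isAddLeftInvariant_eq_smul ((volume : Measure E).map L) volume
    have h2 : (volume : Measure E).map L (ball 0 1) = volume (ball (0 : E) 1) := by
      rw [Measure.map_apply L.continuous.measurable measurableSet_ball, hpre]
    rw [h1, Measure.smul_apply, ENNReal.smul_def, smul_eq_mul] at h2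
    have h3 : ((((volume : Measure E).map L).addHaarScalarFactor volume : ℝ≥0) : ℝ≥0∞) = 1 := by
      have hp : volume (ball (0 : E) 1) ≠ 0 := (measure_ball_pos _ _ one_pos).ne'
      have hf : volume (ball (0 : E) 1) ≠ ∞ := measure_ball_lt_top.ne
      exact (ENNReal.mul_left_inj hp hf).1 (by rw [h2, one_mul])
    rw [h1, show ((volume : Measure E).map L).addHaarScalarFactor volume = 1 by exact_mod_cast h3,
      one_smul]
  have hmp : MeasurePreserving L (volume : Measure E) volume := ⟨L.continuous.measurable, hmap⟩
  calc ∫⁻ v, h (a + (u : ℂ) • v) = ∫⁻ v, (fun z => h (a + z)) (L v) := rfl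
    _ = ∫⁻ z, h (a + z) :=
      hmp.lintegral_comp_emb L.toHomeomorph.measurableEmbedding (fun z => h (a + z))
    _ = ∫⁻ z, h z := lintegral_add_left_eq_self _ _

/-- The mean value inequality over balls for holomorphic functions. -/
theorem enorm_mul_volume_ball_le {f : E → ℂ} {a : E} {r : ℝ}
    (hf : DifferentiableOn ℂ f (ball a r)) :
    ‖f a‖ₑ * volume (ball a r) ≤ ∫⁻ z in ball a r, ‖f z‖ₑ := by
  have : ProperSpace E := FiniteDimensional.proper ℂ E
  let h : E → ℝ≥0∞ := (ball a r).indicator fun z => ‖f z‖ₑ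
  have hm : Measurable h := by
    classical
    have : Measurable ((ball a r).piecewise f 0) :=
      hf.continuousOn.measurable_piecewise continuousOn_const measurableSet_ball
    convert this.enorm using 1
    ext z
    by_cases hz : z ∈ ball a r <;> simp [h, hz]
  let I : Set ℝ := Ioc 0 (2 * Real.pi)
  have hI : volume I = ENNReal.ofReal (2 * Real.pi) := by simp [I]
  have hI0 : volume I ≠ 0 := by rw [hI]; simp [Real.pi_pos]
  have hIt : volume I ≠ ∞ := by rw [hI]; exact ENNReal.ofReal_ne_top
  have key : ∀ v ∈ ball (0 : E) r,
      volume I * ‖f a‖ₑ ≤ ∫⁻ θ in I, h (a + (Circle.exp θ : ℂ) • v) := by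
    intro v hv
    have hv' : ‖v‖ < r := by simpa using hv
    have hmem : ∀ t : ℂ, ‖t‖ ≤ 1 → a + t • v ∈ ball a r := by
      intro t ht
      simp only [mem_ball, dist_self_add_left, norm_smul]
      nlinarith [norm_nonneg v]
    have hd : DifferentiableOn ℂ (fun t : ℂ => f (a + t • v)) (closedBall 0 1) := by
      refine hf.comp (by fun_prop) fun t ht => hmem t (by simpa using ht)
    have hdc : DiffContOnCl ℂ (fun t : ℂ => f (a + t • v)) (ball 0 |1|) := by
      rw [abs_one]
      exact hd.diffContOnCl_ball Subset.rfl
    have h1 := hdc.circleAverage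
    rw [Real.circleAverage, intervalIntegral.integral_of_le (by positivity)] at h1
    simp only [zero_smul, add_zero] at h1
    have h2 : (2 * Real.pi) • f a = ∫ θ in I, f (a + circleMap 0 1 θ • v) := by
      rw [← h1, smul_smul, mul_inv_cancel₀ (by positivity), one_smul]
    calc volume I * ‖f a‖ₑ = ‖(2 * Real.pi) • f a‖ₑ := by
          rw [enorm_smul, hI, Real.enorm_eq_ofReal (by positivity)]
      _ ≤ ∫⁻ θ in I, ‖f (a + circleMap 0 1 θ • v)‖ₑ := by
          rw [h2]; exact enorm_integral_le_lintegral_enorm _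
      _ = ∫⁻ θ in I, h (a + (Circle.exp θ : ℂ) • v) := by
          congr 1 with θ
          have : circleMap 0 1 θ = (Circle.exp θ : ℂ) := by simp [circleMap]
          rw [this]
          exact (indicator_of_mem (hmem _ (by simp)) (fun z => ‖f z‖ₑ)).symm
  have hjm : Measurable fun q : E × ℝ => h (a + (Circle.exp q.2 : ℂ) • q.1) :=
    hm.comp (Continuous.measurable (by fun_prop))
  have hvol : volume (ball a r) = volume (ball (0 : E) r) := Measure.addHaar_ball_center _ _ _
  refine (ENNReal.mul_le_mul_iff_right hI0 hIt).1 ?_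
  calc volume I * (‖f a‖ₑ * volume (ball a r))
      = ∫⁻ _ in ball (0 : E) r, volume I * ‖f a‖ₑ := by
        rw [setLIntegral_const, hvol, mul_assoc]
    _ ≤ ∫⁻ v in ball (0 : E) r, ∫⁻ θ in I, h (a + (Circle.exp θ : ℂ) • v) :=
        setLIntegral_mono' measurableSet_ball key
    _ ≤ ∫⁻ v : E, ∫⁻ θ in I, h (a + (Circle.exp θ : ℂ) • v) := setLIntegral_le_lintegral _ _
    _ = ∫⁻ θ in I, ∫⁻ v : E, h (a + (Circle.exp θ : ℂ) • v) :=
        lintegral_lintegral_swap hjm.aemeasurable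
    _ = ∫⁻ θ in I, ∫⁻ z, h z := by simp_rw [lintegral_rotate]
    _ = volume I * ∫⁻ z in ball a r, ‖f z‖ₑ := by
        rw [setLIntegral_const, mul_comm, lintegral_indicator measurableSet_ball]

/-- On small balls a holomorphic function is bounded by its weighted `L²` norm. -/
theorem exists_ball_bound {Ω : Set E} {μ : E → ℝ} (hΩ : IsOpen Ω) (hμ : ContinuousOn μ Ω)
    (hpos : ∀ z ∈ Ω, 0 < μ z) {a : E} (ha : a ∈ Ω) :
    ∃ r > 0, ball a r ⊆ Ω ∧ ∃ C : ℝ≥0, ∀ f : E → ℂ, DifferentiableOn ℂ f Ω → ∀ z ∈ ball a r,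
      ‖f z‖ₑ ≤ C * eLpNorm f 2 (weightedMeasure Ω μ) := by
  have hc : 0 < μ a := hpos a ha
  have hnear : ∀ᶠ z in 𝓝 a, z ∈ Ω ∧ μ a / 2 < μ z :=
    (show ∀ᶠ z in 𝓝 a, z ∈ Ω from hΩ.mem_nhds ha).and ((hμ.continuousAt (hΩ.mem_nhds ha)).eventually
      (lt_mem_nhds (half_lt_self hc)))
  obtain ⟨R, hR, hball⟩ := Metric.eventually_nhds_iff_ball.1 hnear
  refine ⟨R / 2, by positivity, fun z hz => (hball z (ball_subset_ball (by linarith) hz)).1, ?_⟩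
  set c : ℝ≥0∞ := ENNReal.ofReal (μ a / 2) with hcdef
  set V : ℝ≥0∞ := volume (ball (0 : E) (R / 2)) with hV
  have hc0 : c ≠ 0 := by simp [hcdef, hc]
  have hct : c ≠ ∞ := ENNReal.ofReal_ne_top
  have hV0 : V ≠ 0 := (measure_ball_pos _ _ (by positivity)).ne'
  have : ProperSpace E := FiniteDimensional.proper ℂ E
  have hVt : V ≠ ∞ := measure_ball_lt_top.ne
  have hD : (c * V)⁻¹ ≠ ∞ := ENNReal.inv_ne_top.2 (mul_ne_zero hc0 hV0)
  refine ⟨(((c * V)⁻¹) ^ (1 / 2 : ℝ)).toNNReal, fun f hf z hz => ?_⟩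
  rw [ENNReal.coe_toNNReal (ENNReal.rpow_ne_top_of_nonneg (by norm_num) hD)]
  have hsub : ball z (R / 2) ⊆ ball a R := by
    refine ball_subset_ball' ?_
    have := mem_ball.1 hz
    linarith
  have hsubΩ : ball z (R / 2) ⊆ Ω := fun w hw => (hball w (hsub hw)).1
  have h1 := enorm_mul_volume_ball_le (f := fun w => f w ^ 2) ((hf.mono hsubΩ).pow 2)
  rw [Measure.addHaar_ball_center] at h1
  have h2 : c * ∫⁻ w in ball z (R / 2), ‖f w ^ 2‖ₑ
      ≤ ∫⁻ w, ‖f w‖ₑ ^ (2 : ℝ) ∂(weightedMeasure Ω μ) := by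
    have hwm : AEMeasurable (fun z => ENNReal.ofReal (μ z)) (volume.restrict Ω) :=
      (hμ.aemeasurable hΩ.measurableSet).ennreal_ofReal
    rw [weightedMeasure, lintegral_withDensity_eq_lintegral_mul₀ hwm
      ((hf.continuousOn.aemeasurable hΩ.measurableSet).enorm.pow_const _)]
    rw [← lintegral_const_mul' _ _ hct]
    refine le_trans ?_ (lintegral_mono_set hsubΩ)
    refine setLIntegral_mono' measurableSet_ball fun w hw => ?_
    simp only [Pi.mul_apply, enorm_pow, ENNReal.rpow_ofNat]
    gcongr
    exact ENNReal.ofReal_le_ofReal (hball w (hsub hw)).2.le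
  rw [eLpNorm_eq_lintegral_rpow_enorm_toReal (by norm_num) (by norm_num)]
  simp only [ENNReal.toReal_ofNat]
  rw [← ENNReal.mul_rpow_of_nonneg _ _ (by norm_num)]
  have h3 : ‖f z‖ₑ ^ (2 : ℝ) ≤
      (c * V)⁻¹ * ∫⁻ w, ‖f w‖ₑ ^ (2 : ℝ) ∂(weightedMeasure Ω μ) := by
    rw [mul_comm, ← div_eq_mul_inv, ENNReal.le_div_iff_mul_le
      (Or.inl (mul_ne_zero hc0 hV0)) (Or.inl (ENNReal.mul_ne_top hct hVt))]
    calc ‖f z‖ₑ ^ (2 : ℝ) * (c * V) = c * (‖f z ^ 2‖ₑ * V) := by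
          rw [enorm_pow, ENNReal.rpow_ofNat]; ring
      _ ≤ c * ∫⁻ w in ball z (R / 2), ‖f w ^ 2‖ₑ := by gcongr
      _ ≤ _ := h2
  calc ‖f z‖ₑ = (‖f z‖ₑ ^ (2 : ℝ)) ^ (1 / 2 : ℝ) := by
        rw [← ENNReal.rpow_mul]; norm_num
    _ ≤ _ := ENNReal.rpow_le_rpow h3 (by norm_num)

/-- For a continuous positive weight on an open set, `A²(Ω, μ)` is closed in `L²(Ω, μ)`. -/
theorem isClosed_bergmanSpace {Ω : Set E} {μ : E → ℝ} (hΩ : IsOpen Ω) (hμ : ContinuousOn μ Ω)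
    (hpos : ∀ z ∈ Ω, 0 < μ z) :
    IsClosed (bergmanSpace Ω μ : Set (Lp ℂ 2 (weightedMeasure Ω μ))) := by
  refine isClosed_of_closure_subset fun G hG => ?_
  obtain ⟨F, hF, hFG⟩ := mem_closure_iff_seq_limit.1 hG
  choose f hf hFf using hF
  have hcauchy : ∀ a ∈ Ω, ∃ r > 0, ball a r ⊆ Ω ∧ UniformCauchySeqOn f atTop (ball a r) := by
    intro a ha
    obtain ⟨r, hr, hsub, C, hC⟩ := exists_ball_bound hΩ hμ hpos ha
    refine ⟨r, hr, hsub, ?_⟩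
    rw [Metric.uniformCauchySeqOn_iff]
    intro ε hε
    obtain ⟨N, hN⟩ := Metric.cauchySeq_iff.1 hFG.cauchySeq (ε / (C + 1)) (by positivity)
    refine ⟨N, fun m hm n hn z hz => ?_⟩
    have h1 := hC (f m - f n) ((hf m).sub (hf n)) z hz
    have h2 : eLpNorm (f m - f n) 2 (weightedMeasure Ω μ) = ‖F m - F n‖ₑ := by
      rw [Lp.enorm_def]
      exact eLpNorm_congr_ae (((hFf m).sub (hFf n)).symm.trans (Lp.coeFn_sub _ _).symm)
    rw [h2] at h1
    have h3 : ‖f m z - f n z‖ ≤ C * ‖F m - F n‖ := by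
      have := ENNReal.toReal_mono (ENNReal.mul_ne_top ENNReal.coe_ne_top enorm_ne_top) h1
      simpa using this
    have h4 := hN m hm n hn
    rw [dist_eq_norm] at h4 ⊢
    have hC1 : (0 : ℝ) < C + 1 := by positivity
    rw [lt_div_iff₀ hC1] at h4
    nlinarith [norm_nonneg (F m - F n)]
  have hlim : ∀ z ∈ Ω, ∃ L, Tendsto (fun n => f n z) atTop (𝓝 L) := by
    intro z hz
    obtain ⟨r, hr, -, hu⟩ := hcauchy z hz
    exact cauchySeq_tendsto_of_complete (hu.cauchySeq (mem_ball_self hr))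
  choose! g hg using hlim
  refine ⟨g, fun a ha => ?_, ?_⟩
  · obtain ⟨r, hr, hsub, hu⟩ := hcauchy a ha
    exact (differentiableAt_of_uniformCauchySeqOn hr (fun n => (hf n).mono hsub) hu
      fun z hz => hg z (hsub hz)).differentiableWithinAt
  · obtain ⟨φ, hφ, hae⟩ := (tendstoInMeasure_of_tendsto_Lp hFG).exists_seq_tendsto_ae
    filter_upwards [hae, ae_mem_of_weightedMeasure hΩ.measurableSet μ, ae_all_iff.2 hFf]
      with z h1 h2 h3
    simp only [h3] at h1
    exact tendsto_nhds_unique h1 ((hg z h2).comp hφ.tendsto_atTop)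

theorem hasOrthogonalProjection_bergmanSpace {Ω : Set E} {μ : E → ℝ} (hΩ : IsOpen Ω)
    (hμ : ContinuousOn μ Ω) (hpos : ∀ z ∈ Ω, 0 < μ z) :
    (bergmanSpace Ω μ).HasOrthogonalProjection := by
  have : CompleteSpace (bergmanSpace Ω μ) :=
    (isClosed_bergmanSpace hΩ hμ hpos).completeSpace_coe
  infer_instance

end General

/-- The Hartogs triangle `{(z₁, z₂) : |z₁| < |z₂| < 1}`. -/
def hartogsTriangle : Set (ℂ × ℂ) := {z | ‖z.1‖ < ‖z.2‖ ∧ ‖z.2‖ < 1}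

/-- The weight `μ(z) = |z₂| ^ s`. -/
noncomputable def hartogsWeight (s : ℝ) (z : ℂ × ℂ) : ℝ := ‖z.2‖ ^ s

instance hasOrthogonalProjection_hartogs (s : ℝ) :
    (bergmanSpace hartogsTriangle (hartogsWeight s)).HasOrthogonalProjection := by
  have hpos : ∀ z ∈ hartogsTriangle, 0 < ‖z.2‖ := fun z hz => (norm_nonneg _).trans_lt hz.1
  have : (volume : Measure (ℂ × ℂ)).IsAddHaarMeasure :=
    inferInstanceAs ((volume : Measure ℂ).prod (volume : Measure ℂ)).IsAddHaarMeasure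
  refine hasOrthogonalProjection_bergmanSpace ?_ ?_ ?_
  · have h1 : IsOpen {z : ℂ × ℂ | ‖z.1‖ < ‖z.2‖} := isOpen_lt (by fun_prop) (by fun_prop)
    have h2 : IsOpen {z : ℂ × ℂ | ‖z.2‖ < 1} := isOpen_lt (by fun_prop) (by fun_prop)
    exact h1.inter h2
  · exact ContinuousOn.rpow_const (by fun_prop) fun z hz => Or.inl (hpos z hz).ne'
  · exact fun z hz => Real.rpow_pos_of_pos (hpos z hz) s

/-! Write `q` for `p₀`. The biholomorphism `hartogsMap`, `(w₁, w₂) ↦ (w₁ w₂, w₂)`, carries disc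
times punctured disc onto the Hartogs triangle with Jacobian `|w₂|²`, so the weighted measure
becomes the product of `dA` and `|w₂|^(-(q+2)) dA` (`map_hartogsMap`) and everything splits into
one-variable problems.

In the second variable, `q ≥ 1` forces a square integrable holomorphic function to be `η H(η)` with
`H` holomorphic across 0, and `H` lies in the Bergman space of the disc with weight `|η|^(-q)`.
There the monomials are orthogonal with squared norms `2π / (2n + 2 - q)`, and summing gives
`diskKernel q`. Hence the Bergman kernel in bidisc coordinates is `diskKernel 0` in the first
variable times `w₂ conj(η₂) diskKernel q` in the second. The code does not sum the series: it proves
the reproducing property by Cauchy's formula on circles (`integral_diskKernel_mul`), and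
self-adjointness of the projection then identifies it with the integral operator
(`ae_bergmanProjection_eq_integral`).

Sufficiency is Schur's test (`lintegral_rpow_le_of_schur`). The kernel is dominated by `|w₂| |η₂|`
times a product of factors `1 / |1 - w conj(η)|²`; the test function combines negative powers of `1
- |w_j|`, handled by a Forelli–Rudin estimate, with a power of `|w₂|`. The power of `|w₂|` is where
`p` enters: its exponent can be chosen exactly when `q < p < q'`.

Necessity comes from testing on `z₂ |z₂|^τ`, cut off at `|z₂| = δ`. Its projection is an explicit
multiple of `z₂`, so boundedness becomes an inequality between integrals of powers over `(δ, 1)`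
(`exists_powerIntegral_le_of_bounded`). If `p ≤ q`, then `z₂` itself is not in `Lᵖ`. If `p ≥ q'`,
let `p'` be the exponent conjugate to `p`: the choice `τ = p' - 2`, the extremal one for the dual
norm of the functional giving the coefficient of `z₂`, makes this functional unbounded as `δ → 0`.

The last claim follows by letting `q` tend to 2, where `(q, q')` shrinks to the point 2. -/

open scoped ComplexConjugate

/-! ### Integration over the unit disc in polar coordinates. -/

section Polar

theorem polarCoord_symm_eq_circleMap (x : ℝ × ℝ) :
    Complex.polarCoord.symm x = circleMap 0 x.1 x.2 := by
  rw [Complex.polarCoord_symm_apply, circleMap, Complex.exp_mul_I]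
  simp

theorem circleMap_mem_unitBall {r θ : ℝ} (hr : 0 < r) :
    circleMap 0 r θ ∈ ball (0 : ℂ) 1 ↔ r < 1 := by
  simp [abs_of_pos hr]

theorem polarCoord_target_inter :
    (Ioi (0 : ℝ) ×ˢ Ioo (-Real.pi) Real.pi) ∩ {x | x.1 < 1} =
      Ioo (0 : ℝ) 1 ×ˢ Ioo (-Real.pi) Real.pi := by
  ext x
  simp only [mem_inter_iff, mem_prod, mem_Ioi, mem_Ioo, mem_ofPred_eq]
  tauto

theorem lintegral_unitBall_eq_polar {f : ℂ → ℝ≥0∞} (hf : Measurable f) :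
    ∫⁻ z in ball (0 : ℂ) 1, f z =
      ∫⁻ r in Ioo (0 : ℝ) 1, ENNReal.ofReal r *
        ∫⁻ θ in Ioo (-Real.pi) Real.pi, f (circleMap 0 r θ) := by
  have hm : Measurable fun x : ℝ × ℝ => f (circleMap 0 x.1 x.2) :=
    hf.comp (Continuous.measurable (by unfold circleMap; fun_prop))
  have hlt : MeasurableSet {x : ℝ × ℝ | x.1 < 1} := measurableSet_lt measurable_fst measurable_const
  rw [← lintegral_indicator measurableSet_ball, ← Complex.lintegral_comp_polarCoord_symm,
    polarCoord_target]
  simp_rw [polarCoord_symm_eq_circleMap]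
  calc _ = ∫⁻ x in Ioi (0 : ℝ) ×ˢ Ioo (-Real.pi) Real.pi,
        {x : ℝ × ℝ | x.1 < 1}.indicator
          (fun x => ENNReal.ofReal x.1 * f (circleMap 0 x.1 x.2)) x := by
        refine setLIntegral_congr_fun (measurableSet_Ioi.prod measurableSet_Ioo) fun x hx => ?_
        have h1 := circleMap_mem_unitBall (θ := x.2) (mem_Ioi.1 hx.1)
        by_cases h : x.1 < 1
        · simp only [indicator_of_mem (h1.2 h), smul_eq_mul]
          rw [indicator_of_mem (by exact h)]
        · simp only [indicator_of_notMem (mt h1.1 h), smul_eq_mul, mul_zero]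
          rw [indicator_of_notMem (by exact h)]
    _ = ∫⁻ x in Ioo (0 : ℝ) 1 ×ˢ Ioo (-Real.pi) Real.pi,
          ENNReal.ofReal x.1 * f (circleMap 0 x.1 x.2) := by
        rw [setLIntegral_indicator hlt, inter_comm, polarCoord_target_inter]
    _ = _ := by
        rw [Measure.volume_eq_prod, setLIntegral_prod _
          (by exact (measurable_fst.ennreal_ofReal.mul hm).aemeasurable)]
        refine lintegral_congr fun r => ?_
        have hr : Measurable fun θ => f (circleMap 0 r θ) := hm.comp measurable_prodMk_left
        exact lintegral_const_mul (ENNReal.ofReal r) hr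

theorem circleAverage_eq_integral_Ioo (f : ℂ → ℂ) (r : ℝ) :
    (2 * Real.pi) • Real.circleAverage f 0 r =
      ∫ θ in Ioo (-Real.pi) Real.pi, f (circleMap 0 r θ) := by
  have hper : Function.Periodic (fun θ => f (circleMap 0 r θ)) (2 * Real.pi) := fun θ => by
    simp only [periodic_circleMap 0 r θ]
  rw [Real.circleAverage, smul_smul, mul_inv_cancel₀ (by positivity), one_smul,
    ← integral_Ioc_eq_integral_Ioo, ← intervalIntegral.integral_of_le (by linarith [Real.pi_pos])]
  have := hper.intervalIntegral_add_eq 0 (-Real.pi)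
  rw [zero_add] at this
  rw [this]
  congr 1
  ring

/-- The Jacobian of polar coordinates is `r`. Integrability in `(r, θ)` is what licenses Fubini in
the formulas by circle averages. -/
theorem integrableOn_comp_polarCoord_symm {f : ℂ → ℂ} (hf : Integrable f) :
    IntegrableOn (fun x : ℝ × ℝ => x.1 • f (Complex.polarCoord.symm x)) polarCoord.target := by
  have h1 : Integrable (f ∘ Complex.measurableEquivRealProd.symm) :=
    Complex.volume_preserving_equiv_real_prod.symm.integrable_comp_of_integrable hf
  have h2 := (integrableOn_image_iff_integrableOn_abs_det_fderiv_smul volume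
    polarCoord.open_target.measurableSet
    (fun x _ => (hasFDerivAt_polarCoord_symm x).hasFDerivWithinAt) polarCoord.symm.injOn
    (f ∘ Complex.measurableEquivRealProd.symm)).1 h1.integrableOn
  refine h2.congr_fun (fun x hx => ?_) polarCoord.open_target.measurableSet
  have hx1 : 0 < x.1 := by
    rw [polarCoord_target] at hx
    exact hx.1
  simp only [det_fderivPolarCoordSymm, abs_of_pos hx1, Function.comp_apply,
    Complex.measurableEquivRealProd_symm_polarCoord_symm_apply, Complex.polarCoord_symm_apply]

theorem integrableOn_polar {f : ℂ → ℂ} (hf : IntegrableOn f (ball 0 1)) :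
    IntegrableOn (fun x : ℝ × ℝ => x.1 • f (circleMap 0 x.1 x.2))
      (Ioo (0 : ℝ) 1 ×ˢ Ioo (-Real.pi) Real.pi) := by
  have h1 : Integrable ((ball (0 : ℂ) 1).indicator f) :=
    (integrable_indicator_iff measurableSet_ball).2 hf
  have h2 : IntegrableOn (fun x : ℝ × ℝ => x.1 • (ball (0 : ℂ) 1).indicator f
      (Complex.polarCoord.symm x)) polarCoord.target :=
    integrableOn_comp_polarCoord_symm h1
  rw [polarCoord_target] at h2
  have hsub : Ioo (0 : ℝ) 1 ×ˢ Ioo (-Real.pi) Real.pi ⊆ Ioi (0 : ℝ) ×ˢ Ioo (-Real.pi) Real.pi :=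
    prod_mono Ioo_subset_Ioi_self Subset.rfl
  refine (h2.mono_set hsub).congr_fun (fun x hx => ?_) (measurableSet_Ioo.prod measurableSet_Ioo)
  simp only [polarCoord_symm_eq_circleMap]
  rw [indicator_of_mem ((circleMap_mem_unitBall hx.1.1).2 hx.1.2)]

theorem integrableOn_smul_circleAverage {f : ℂ → ℂ} (hf : IntegrableOn f (ball 0 1)) :
    IntegrableOn (fun r : ℝ => (2 * Real.pi * r) • Real.circleAverage f 0 r) (Ioo 0 1) := by
  have h := integrableOn_polar hf
  rw [IntegrableOn, Measure.volume_eq_prod, ← Measure.prod_restrict] at h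
  refine h.integral_prod_left.congr (Eventually.of_forall fun r => ?_)
  simp only
  rw [mul_comm, mul_smul, circleAverage_eq_integral_Ioo, integral_smul]

theorem integral_unitBall_eq_circleAverage {f : ℂ → ℂ} (hf : IntegrableOn f (ball 0 1)) :
    ∫ z in ball (0 : ℂ) 1, f z =
      ∫ r in Ioo (0 : ℝ) 1, (2 * Real.pi * r) • Real.circleAverage f 0 r := by
  have h := integrableOn_polar hf
  have hlt : MeasurableSet {x : ℝ × ℝ | x.1 < 1} := measurableSet_lt measurable_fst measurable_const
  rw [← integral_indicator measurableSet_ball, ← Complex.integral_comp_polarCoord_symm,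
    polarCoord_target]
  simp_rw [polarCoord_symm_eq_circleMap]
  calc _ = ∫ x in Ioi (0 : ℝ) ×ˢ Ioo (-Real.pi) Real.pi,
        {x : ℝ × ℝ | x.1 < 1}.indicator
          (fun x => x.1 • f (circleMap 0 x.1 x.2)) x := by
        refine setIntegral_congr_fun (measurableSet_Ioi.prod measurableSet_Ioo) fun x hx => ?_
        have h1 := circleMap_mem_unitBall (θ := x.2) (mem_Ioi.1 hx.1)
        by_cases h : x.1 < 1
        · simp only [indicator_of_mem (h1.2 h)]
          rw [indicator_of_mem (by exact h)]
        · simp only [indicator_of_notMem (mt h1.1 h), smul_zero]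
          rw [indicator_of_notMem (by exact h)]
    _ = ∫ x in Ioo (0 : ℝ) 1 ×ˢ Ioo (-Real.pi) Real.pi, x.1 • f (circleMap 0 x.1 x.2) := by
        rw [setIntegral_indicator hlt, polarCoord_target_inter]
    _ = _ := by
        rw [Measure.volume_eq_prod] at h ⊢
        rw [setIntegral_prod _ h]
        refine integral_congr_ae (Eventually.of_forall fun r => ?_)
        simp only
        rw [integral_smul, mul_comm (2 * Real.pi), mul_smul, circleAverage_eq_integral_Ioo]

end Polar

/-! ### The weighted Bergman kernel of the disc and its action on circles. -/

section Kernel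

/-- The Bergman kernel of the unit disc with weight `|η| ^ (-q)`, as a function of `t = w * conj η`. -/
noncomputable def diskKernel (q : ℝ) (t : ℂ) : ℂ :=
  (2 * Real.pi : ℂ)⁻¹ * (2 / (1 - t) ^ 2 - q / (1 - t))

/-- On `|η| = r` one has `conj η = r² / η`, so the kernel is a rational function of `η` with its
pole at `u = w r²`, inside the circle. Cauchy's formulas for a function and for its derivative then
evaluate the average. -/
theorem circleAverage_diskKernel_mul {q : ℝ} {h : ℂ → ℂ} (hh : DifferentiableOn ℂ h (ball 0 1))
    {w : ℂ} (hw : w ∈ ball (0 : ℂ) 1) {r : ℝ} (hr0 : 0 < r) (hr1 : r < 1) :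
    Real.circleAverage (fun η => diskKernel q (w * conj η) * h η) 0 r =
      (2 * Real.pi : ℂ)⁻¹ *
        (2 * (w * r ^ 2) * deriv h (w * r ^ 2) + (2 - q) * h (w * r ^ 2)) := by
  set u : ℂ := w * r ^ 2 with hu
  have hw1 : ‖w‖ < 1 := by simpa using hw
  have hur : u ∈ ball (0 : ℂ) r := by
    simp only [hu, mem_ball_zero_iff, norm_mul, norm_pow, Complex.norm_real, Real.norm_eq_abs,
      abs_of_pos hr0]
    nlinarith [norm_nonneg w, mul_pos hr0 hr0]
  have hne : ∀ η ∈ sphere (0 : ℂ) r, η - u ≠ 0 := fun η hη h => by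
    rw [sub_eq_zero.1 h, mem_sphere_zero_iff_norm] at hη
    rw [mem_ball_zero_iff, hη] at hur
    exact lt_irrefl _ hur
  have hsub : closedBall (0 : ℂ) r ⊆ ball 0 1 := closedBall_subset_ball hr1
  have hcont : ContinuousOn h (sphere 0 r) :=
    hh.continuousOn.mono (sphere_subset_closedBall.trans hsub)
  -- Since `1 - u / η = (η - u) / η`, the double pole together with `dη / η` leaves `η / (η - u)²`;
  -- hence the derivative formula is applied to `η h(η)`.
  have e1 := Complex.two_pi_I_inv_smul_circleIntegral_sub_sq_inv_smul_of_differentiable isOpen_ball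
    hsub (f := fun η => η * h η) (differentiableOn_id.mul hh) hur
  have e2 := Complex.two_pi_I_inv_smul_circleIntegral_sub_inv_smul_of_differentiable_on_off_countable
    countable_empty hur (hh.continuousOn.mono hsub)
    (fun x hx => hh.differentiableAt (isOpen_ball.mem_nhds (hsub (ball_subset_closedBall hx.1))))
  have hhu : DifferentiableAt ℂ h u :=
    hh.differentiableAt (isOpen_ball.mem_nhds (hsub (ball_subset_closedBall hur)))
  have hd : deriv (fun η => η * h η) u = h u + u * deriv h u := by
    rw [deriv_fun_mul differentiableAt_fun_id hhu]
    simp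
  rw [hd] at e1
  rw [Real.circleAverage_eq_circleIntegral hr0.ne']
  have hI : (∮ η in C(0, r), (η - 0)⁻¹ • (diskKernel q (w * conj η) * h η)) =
      ∮ η in C(0, r), (2 * Real.pi : ℂ)⁻¹ * 2 * (((η - u) ^ 2)⁻¹ • (η * h η)) -
        (2 * Real.pi : ℂ)⁻¹ * q * ((η - u)⁻¹ • h η) := by
    refine circleIntegral.integral_congr hr0.le fun η hη => ?_
    have hη0 : η ≠ 0 := by
      rintro rfl
      simp [hr0.ne] at hη
    have hc : conj η = r ^ 2 / η := by
      rw [eq_div_iff hη0, mul_comm, Complex.mul_conj, Complex.normSq_eq_norm_sq,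
        mem_sphere_zero_iff_norm.1 hη]
      push_cast
      rfl
    have h1 : w * conj η = u / η := by rw [hc, hu]; ring
    have h2 := hne η hη
    have h3 : 1 - u / η = (η - u) / η := by field_simp
    simp only [h1, diskKernel, h3, smul_eq_mul, sub_zero]
    field_simp
  rw [hI, circleIntegral.integral_sub, circleIntegral.integral_const_mul,
    circleIntegral.integral_const_mul]
  · simp only [smul_eq_mul] at e1 e2 ⊢
    linear_combination (2 * Real.pi : ℂ)⁻¹ * 2 * e1 - (2 * Real.pi : ℂ)⁻¹ * q * e2
  · refine ContinuousOn.circleIntegrable hr0.le ?_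
    refine continuousOn_const.mul (ContinuousOn.smul (ContinuousOn.inv₀ (by fun_prop)
      fun η hη => pow_ne_zero _ (hne η hη)) (continuousOn_id.mul hcont))
  · refine ContinuousOn.circleIntegrable hr0.le ?_
    exact continuousOn_const.mul (ContinuousOn.smul (ContinuousOn.inv₀ (by fun_prop)
      fun η hη => hne η hη) hcont)

/-- The reproducing property of the weighted Bergman kernel of the disc. -/
theorem integral_diskKernel_mul {q : ℝ} (hq : q < 2) {h : ℂ → ℂ}
    (hh : DifferentiableOn ℂ h (ball 0 1)) {w : ℂ} (hw : w ∈ ball (0 : ℂ) 1)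
    (hint : IntegrableOn (fun η => diskKernel q (w * conj η) * h η * (‖η‖ ^ (-q) : ℝ))
      (ball 0 1)) :
    ∫ η in ball (0 : ℂ) 1, diskKernel q (w * conj η) * h η * (‖η‖ ^ (-q) : ℝ) = h w := by
  have hw1 : ‖w‖ < 1 := by simpa using hw
  have key : ∀ r ∈ Ioo (0 : ℝ) 1, (2 * Real.pi * r) • Real.circleAverage
      (fun η => diskKernel q (w * conj η) * h η * (‖η‖ ^ (-q) : ℝ)) 0 r =
      (r ^ (1 - q) : ℝ) * (2 * (w * r ^ 2) * deriv h (w * r ^ 2) + (2 - q) * h (w * r ^ 2)) := by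
    intro r hr
    have h1 : Real.circleAverage
        (fun η => diskKernel q (w * conj η) * h η * (‖η‖ ^ (-q) : ℝ)) 0 r =
        (r ^ (-q) : ℝ) * Real.circleAverage (fun η => diskKernel q (w * conj η) * h η) 0 r := by
      rw [← smul_eq_mul, ← Real.circleAverage_fun_smul]
      refine Real.circleAverage_congr_sphere fun η hη => ?_
      rw [abs_of_pos hr.1, mem_sphere_zero_iff_norm] at hη
      simp only [hη, smul_eq_mul]
      ring
    rw [h1, circleAverage_diskKernel_mul hh hw hr.1 hr.2, sub_eq_add_neg (1 : ℝ),
      Real.rpow_add hr.1, Real.rpow_one, Complex.real_smul]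
    have := Real.pi_ne_zero
    push_cast
    field_simp
  have hI := integrableOn_smul_circleAverage hint
  rw [integral_unitBall_eq_circleAverage hint, setIntegral_congr_fun measurableSet_Ioo key,
    ← integral_Ioc_eq_integral_Ioo, ← intervalIntegral.integral_of_le zero_le_one]
  have hmem : ∀ r ∈ Icc (0 : ℝ) 1, w * r ^ 2 ∈ ball (0 : ℂ) 1 := fun r hr => by
    simp only [mem_ball_zero_iff, norm_mul, norm_pow, Complex.norm_real, Real.norm_eq_abs,
      abs_of_nonneg hr.1]
    have : r ^ 2 ≤ 1 := pow_le_one₀ hr.1 hr.2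
    nlinarith [norm_nonneg w, sq_nonneg r]
  -- The radial integrand is the exact derivative of `r^(2-q) h(w r²)`. This primitive equals `h w`
  -- at 1, and vanishes at 0 because `q < 2`.
  have hFTC := intervalIntegral.integral_eq_sub_of_hasDeriv_right (a := 0) (b := 1)
    (f := fun r : ℝ => ((r ^ (2 - q) : ℝ) : ℂ) * h (w * r ^ 2))
    (f' := fun r : ℝ => (r ^ (1 - q) : ℝ) *
      (2 * (w * r ^ 2) * deriv h (w * r ^ 2) + (2 - q) * h (w * r ^ 2))) ?_ ?_ ?_
  · rw [hFTC]
    simp [Real.zero_rpow (by linarith : (2 - q) ≠ 0)]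
  · rw [uIcc_of_le zero_le_one]
    refine ContinuousOn.mul (Complex.continuous_ofReal.comp_continuousOn
      (continuousOn_id.rpow_const fun _ _ => Or.inr (by linarith))) ?_
    exact hh.continuousOn.comp (by fun_prop) fun r hr => hmem r hr
  · rw [min_eq_left zero_le_one, max_eq_right zero_le_one]
    intro r hr
    have hd : HasDerivAt h (deriv h (w * r ^ 2)) (w * (r : ℂ) ^ 2) :=
      (hh.differentiableAt (isOpen_ball.mem_nhds (hmem r ⟨hr.1.le, hr.2.le⟩))).hasDerivAt
    have hin : HasDerivAt (fun x : ℂ => w * x ^ 2) (w * (2 * r)) (r : ℂ) := by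
      simpa using (hasDerivAt_pow 2 (r : ℂ)).const_mul w
    have h1 : HasDerivAt (fun x : ℝ => h (w * x ^ 2)) (deriv h (w * r ^ 2) * (w * (2 * r))) r :=
      (HasDerivAt.comp (r : ℂ) hd hin).comp_ofReal
    have h2 : HasDerivAt (fun x : ℝ => ((x ^ (2 - q) : ℝ) : ℂ))
        (((2 - q) * r ^ (2 - q - 1) : ℝ) : ℂ) r :=
      (Real.hasDerivAt_rpow_const (Or.inl hr.1.ne')).ofReal_comp
    have h3 := (h2.mul h1).hasDerivWithinAt (s := Ioi r)
    have e1 : r ^ (2 - q - 1) = r ^ (1 - q) := by ring_nf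
    have e2 : r ^ (2 - q) = r ^ (1 - q) * r := by
      rw [← Real.rpow_add_one hr.1.ne']
      ring_nf
    refine h3.congr_deriv ?_
    rw [e1, e2]
    push_cast
    ring
  · rw [intervalIntegrable_iff_integrableOn_Ioo_of_le zero_le_one]
    exact hI.congr_fun key measurableSet_Ioo

/-- The kernel integral of a function of the modulus. -/
theorem integral_diskKernel_mul_radial {q : ℝ} {ψ : ℝ → ℝ} {w : ℂ} (hw : w ∈ ball (0 : ℂ) 1)
    (hint : IntegrableOn (fun η => diskKernel q (w * conj η) * (ψ ‖η‖ : ℝ)) (ball 0 1)) :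
    ∫ η in ball (0 : ℂ) 1, diskKernel q (w * conj η) * (ψ ‖η‖ : ℝ) =
      ((2 - q) * ∫ r in Ioo (0 : ℝ) 1, r * ψ r : ℝ) := by
  rw [integral_unitBall_eq_circleAverage hint, ← integral_const_mul, ← integral_complex_ofReal]
  refine setIntegral_congr_fun measurableSet_Ioo fun r hr => ?_
  have h1 : Real.circleAverage (fun η => diskKernel q (w * conj η) * (ψ ‖η‖ : ℝ)) 0 r =
      (ψ r : ℂ) * Real.circleAverage (fun η => diskKernel q (w * conj η) * 1) 0 r := by
    rw [← smul_eq_mul, ← Real.circleAverage_fun_smul]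
    refine Real.circleAverage_congr_sphere fun η hη => ?_
    rw [abs_of_pos hr.1, mem_sphere_zero_iff_norm] at hη
    simp only [hη, smul_eq_mul]
    ring
  -- For `h = 1` the average is `(2 - q) / 2π`, independent of `w` and `r`: only the constant term
  -- of the kernel survives.
  rw [h1, circleAverage_diskKernel_mul (h := fun _ => 1) (differentiableOn_const _) hw hr.1 hr.2,
    Complex.real_smul]
  have := Real.pi_ne_zero
  simp only [deriv_const]
  push_cast
  field_simp
  ring

end Kernel

/-! ### Forelli–Rudin estimates for the kernel. -/

section Estimates

/-- A non-negative derivative of a function continuous up to the endpoints is automatically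
integrable, so integrands singular at an endpoint are covered. -/
theorem lintegral_Ioo_eq_ofReal_sub {a b : ℝ} (hab : a ≤ b) {F f : ℝ → ℝ}
    (hF : ContinuousOn F (Icc a b)) (hd : ∀ x ∈ Ioo a b, HasDerivAt F (f x) x)
    (hf : ∀ x ∈ Ioo a b, 0 ≤ f x) :
    ∫⁻ x in Ioo a b, ENNReal.ofReal (f x) = ENNReal.ofReal (F b - F a) := by
  have hi := intervalIntegral.integrableOn_deriv_of_nonneg hF hd hf
  have h1 := intervalIntegral.integral_eq_sub_of_hasDerivAt_of_le hab hF hd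
    ((intervalIntegrable_iff_integrableOn_Ioc_of_le hab).2 hi)
  rw [← h1, intervalIntegral.integral_of_le hab, integral_Ioc_eq_integral_Ioo]
  rw [integrableOn_Ioc_iff_integrableOn_Ioo] at hi
  rw [ofReal_integral_eq_lintegral_ofReal hi
    ((ae_restrict_iff' measurableSet_Ioo).2 (Eventually.of_forall hf))]

theorem lintegral_Ioo_rpow {γ : ℝ} (hγ : -1 < γ) :
    ∫⁻ r in Ioo (0 : ℝ) 1, ENNReal.ofReal (r ^ γ) = ENNReal.ofReal (1 / (γ + 1)) := by
  have h : (γ + 1) ≠ 0 := by linarith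
  rw [lintegral_Ioo_eq_ofReal_sub zero_le_one (F := fun r => r ^ (γ + 1) / (γ + 1))]
  · simp [Real.zero_rpow h]
  · exact (continuousOn_id.rpow_const fun _ _ => Or.inr (by linarith)).div_const _
  · intro x hx
    refine ((Real.hasDerivAt_rpow_const (p := γ + 1) (Or.inl hx.1.ne')).div_const _).congr_deriv ?_
    rw [add_sub_cancel_right]
    field_simp
  · exact fun x hx => Real.rpow_nonneg hx.1.le _

theorem hasDerivAt_one_sub_rpow {p x : ℝ} (hx : x < 1) :
    HasDerivAt (fun r : ℝ => (1 - r) ^ p) (-(p * (1 - x) ^ (p - 1))) x := by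
  have h1 : HasDerivAt (fun r : ℝ => 1 - r) (-1) x := by
    simpa using (hasDerivAt_id x).const_sub 1
  refine (h1.rpow_const (p := p) (Or.inl (by linarith))).congr_deriv ?_
  ring

theorem lintegral_Ioo_one_sub_rpow_left {α x : ℝ} (hα : 0 < α) (hx0 : 0 ≤ x) (hx1 : x < 1) :
    ∫⁻ r in Ioo 0 x, ENNReal.ofReal ((1 - r) ^ (-α - 1)) ≤
      ENNReal.ofReal (1 / α * (1 - x) ^ (-α)) := by
  rw [lintegral_Ioo_eq_ofReal_sub hx0 (F := fun r => (1 - r) ^ (-α) / α)]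
  · refine ENNReal.ofReal_le_ofReal ?_
    have : 0 ≤ (1 - 0 : ℝ) ^ (-α) / α := by positivity
    have h2 : (1 - x) ^ (-α) / α = 1 / α * (1 - x) ^ (-α) := by ring
    linarith
  · refine ContinuousOn.div_const (ContinuousOn.rpow_const (by fun_prop) fun r hr => Or.inl ?_) _
    linarith [hr.2]
  · intro r hr
    refine ((hasDerivAt_one_sub_rpow (p := -α) (hr.2.trans hx1)).div_const _).congr_deriv ?_
    field_simp
  · exact fun r hr => Real.rpow_nonneg (by linarith [hr.2]) _

theorem lintegral_Ioo_one_sub_rpow_right {α x : ℝ} (hα : α < 1) (hx1 : x < 1) :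
    ∫⁻ r in Ioo x 1, ENNReal.ofReal ((1 - r) ^ (-α)) =
      ENNReal.ofReal (1 / (1 - α) * (1 - x) ^ (1 - α)) := by
  have h : 1 - α ≠ 0 := by linarith
  rw [lintegral_Ioo_eq_ofReal_sub hx1.le (F := fun r => -((1 - r) ^ (1 - α) / (1 - α)))]
  · rw [sub_self, Real.zero_rpow h]
    ring_nf
  · exact (ContinuousOn.div_const (ContinuousOn.rpow_const (by fun_prop)
      fun r hr => Or.inr (by linarith)) _).neg
  · intro r hr
    refine ((hasDerivAt_one_sub_rpow (p := 1 - α) hr.2).div_const _).fun_neg.congr_deriv ?_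
    rw [show 1 - α - 1 = -α by ring]
    field_simp
  · exact fun r hr => Real.rpow_nonneg (by linarith [hr.2]) _

/-- The singularities at 0 and 1 are separated at `r = 1/2`. Below, only `r^γ` matters: `(1-r)^(-α)
≤ 2` and `1 - x r ≥ 1/2` give the constant 4. Above, `r^γ ≤ 2^|γ|`, and `1 - x r` dominates both `1
- r` and `1 - x`, of which the larger is used. -/
theorem one_sub_rpow_mul_rpow_div_le {α γ : ℝ} (hα0 : 0 < α) (hα1 : α < 1) {x r : ℝ}
    (hx0 : 0 ≤ x) (hx1 : x < 1) (hr0 : 0 < r) (hr1 : r < 1) :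
    (1 - r) ^ (-α) * r ^ γ / (1 - x * r) ≤ 4 * (1 - x) ^ (-α) * r ^ γ + 2 ^ |γ| *
      (if r < x then (1 - r) ^ (-α - 1) else (1 - x)⁻¹ * (1 - r) ^ (-α)) := by
  have hxr : 0 < 1 - x * r := by nlinarith
  have hr : 0 < 1 - r := by linarith
  have hx : 0 < 1 - x := by linarith
  have hif : 0 ≤ (if r < x then (1 - r) ^ (-α - 1) else (1 - x)⁻¹ * (1 - r) ^ (-α)) := by
    split_ifs <;> positivity
  rcases le_total r (1 / 2) with h | h
  · have h1 : (1 - r) ^ (-α) ≤ 2 := by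
      calc (1 - r) ^ (-α) ≤ (1 / 2 : ℝ) ^ (-α) :=
            Real.rpow_le_rpow_of_nonpos (by norm_num) (by linarith) (by linarith)
        _ = 2 ^ α := by rw [one_div, Real.inv_rpow (by norm_num), Real.rpow_neg (by norm_num), inv_inv]
        _ ≤ 2 ^ (1 : ℝ) := Real.rpow_le_rpow_of_exponent_le (by norm_num) hα1.le
        _ = 2 := Real.rpow_one _
    have h2 : 1 ≤ (1 - x) ^ (-α) :=
      Real.one_le_rpow_of_pos_of_le_one_of_nonpos hx (by linarith) (by linarith)
    have h3 : 1 / 2 ≤ 1 - x * r := by nlinarith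
    have h4 : 0 < r ^ γ := Real.rpow_pos_of_pos hr0 _
    have h5 : (1 - r) ^ (-α) * r ^ γ / (1 - x * r) ≤ 4 * (1 - x) ^ (-α) * r ^ γ := by
      rw [div_le_iff₀ hxr]
      calc (1 - r) ^ (-α) * r ^ γ ≤ 2 * r ^ γ := by gcongr
        _ = 4 * 1 * r ^ γ * (1 / 2) := by ring
        _ ≤ 4 * (1 - x) ^ (-α) * r ^ γ * (1 - x * r) := by gcongr
    have : 0 ≤ (2 : ℝ) ^ |γ| := by positivity
    nlinarith [mul_nonneg this hif]
  · have h1 : r ^ γ ≤ 2 ^ |γ| := by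
      calc r ^ γ ≤ r ^ (-|γ|) := Real.rpow_le_rpow_of_exponent_ge hr0 hr1.le (neg_abs_le γ)
        _ ≤ (1 / 2 : ℝ) ^ (-|γ|) :=
            Real.rpow_le_rpow_of_nonpos (by norm_num) h (by simp)
        _ = 2 ^ |γ| := by
            rw [one_div, Real.inv_rpow (by norm_num), Real.rpow_neg (by norm_num), inv_inv]
    have h2 : (1 - r) ^ (-α) / (1 - x * r) ≤
        (if r < x then (1 - r) ^ (-α - 1) else (1 - x)⁻¹ * (1 - r) ^ (-α)) := by
      split_ifs with hlt
      · rw [Real.rpow_sub_one hr.ne']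
        gcongr
        nlinarith
      · rw [div_eq_inv_mul]
        gcongr
        nlinarith
    have h3 : 0 ≤ 4 * (1 - x) ^ (-α) * r ^ γ := by positivity
    calc (1 - r) ^ (-α) * r ^ γ / (1 - x * r) = r ^ γ * ((1 - r) ^ (-α) / (1 - x * r)) := by ring
      _ ≤ 2 ^ |γ| * _ := mul_le_mul h1 h2 (by positivity) (by positivity)
      _ ≤ _ := by linarith

/-- After the pointwise bound, the pieces on either side of `r = x` integrate to multiples of
`(1-x)^(-α)`: `α > 0` is needed to the left of `x`, `α < 1` to the right, and `γ > -1` at the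
origin. -/
theorem exists_lintegral_one_sub_rpow_le {α γ : ℝ} (hα0 : 0 < α) (hα1 : α < 1) (hγ : -1 < γ) :
    ∃ C : ℝ≥0, ∀ x : ℝ, 0 ≤ x → x < 1 →
      ∫⁻ r in Ioo (0 : ℝ) 1, ENNReal.ofReal ((1 - r) ^ (-α) * r ^ γ / (1 - x * r)) ≤
        C * ENNReal.ofReal ((1 - x) ^ (-α)) := by
  refine ⟨Real.toNNReal (4 / (γ + 1) + 2 ^ |γ| * (1 / α + 1 / (1 - α))), fun x hx0 hx1 => ?_⟩
  have hx : 0 < 1 - x := by linarith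
  have hα' : 0 < 1 - α := by linarith
  have hγ' : 0 < γ + 1 := by linarith
  set g : ℝ → ℝ := fun r =>
    if r < x then (1 - r) ^ (-α - 1) else (1 - x)⁻¹ * (1 - r) ^ (-α) with hg
  have hgm : Measurable g := Measurable.ite measurableSet_Iio (by fun_prop) (by fun_prop)
  have hg0 : ∀ r ∈ Ioo (0 : ℝ) 1, 0 ≤ g r := fun r hr => by
    have : 0 < 1 - r := by linarith [hr.2]
    simp only [hg]
    split_ifs <;> positivity
  have hgint : ∫⁻ r in Ioo (0 : ℝ) 1, ENNReal.ofReal (g r) ≤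
      ENNReal.ofReal ((1 / α + 1 / (1 - α)) * (1 - x) ^ (-α)) := by
    have hsub : Ioo (0 : ℝ) 1 ⊆ Ioo 0 x ∪ Ico x 1 := fun r hr => by
      rcases lt_or_ge r x with h | h
      · exact Or.inl ⟨hr.1, h⟩
      · exact Or.inr ⟨h, hr.2⟩
    have h1 : ∫⁻ r in Ioo 0 x, ENNReal.ofReal (g r) ≤ ENNReal.ofReal (1 / α * (1 - x) ^ (-α)) := by
      refine le_trans (le_of_eq ?_) (lintegral_Ioo_one_sub_rpow_left hα0 hx0 hx1)
      exact setLIntegral_congr_fun measurableSet_Ioo fun r hr => by simp only [hg, if_pos hr.2]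
    have h2 : ∫⁻ r in Ico x 1, ENNReal.ofReal (g r) =
        ENNReal.ofReal (1 / (1 - α) * (1 - x) ^ (-α)) := by
      rw [setLIntegral_congr Ioo_ae_eq_Ico.symm]
      calc _ = ∫⁻ r in Ioo x 1, ENNReal.ofReal ((1 - x)⁻¹) * ENNReal.ofReal ((1 - r) ^ (-α)) := by
            refine setLIntegral_congr_fun measurableSet_Ioo fun r hr => ?_
            simp only [hg, if_neg hr.1.not_gt]
            rw [ENNReal.ofReal_mul (by positivity)]
        _ = _ := by
            rw [lintegral_const_mul _ (by fun_prop), lintegral_Ioo_one_sub_rpow_right hα1 hx1,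
              ← ENNReal.ofReal_mul (by positivity), show 1 - α = -α + 1 by ring,
              Real.rpow_add_one hx.ne']
            congr 1
            field_simp
    calc _ ≤ ∫⁻ r in Ioo 0 x ∪ Ico x 1, ENNReal.ofReal (g r) := lintegral_mono_set hsub
      _ ≤ _ := lintegral_union_le _ _ _
      _ ≤ ENNReal.ofReal (1 / α * (1 - x) ^ (-α)) +
          ENNReal.ofReal (1 / (1 - α) * (1 - x) ^ (-α)) := by rw [h2]; gcongr
      _ = _ := by rw [← ENNReal.ofReal_add (by positivity) (by positivity), add_mul]
  calc _ ≤ ∫⁻ r in Ioo (0 : ℝ) 1, (ENNReal.ofReal (4 * (1 - x) ^ (-α)) * ENNReal.ofReal (r ^ γ) +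
        ENNReal.ofReal (2 ^ |γ|) * ENNReal.ofReal (g r)) := by
        refine setLIntegral_mono (by fun_prop) fun r hr => ?_
        have := Real.rpow_nonneg hr.1.le γ
        rw [← ENNReal.ofReal_mul (by positivity), ← ENNReal.ofReal_mul (by positivity),
          ← ENNReal.ofReal_add (by positivity) (mul_nonneg (by positivity) (hg0 r hr))]
        exact ENNReal.ofReal_le_ofReal
          (one_sub_rpow_mul_rpow_div_le hα0 hα1 hx0 hx1 hr.1 hr.2)
    _ = ENNReal.ofReal (4 * (1 - x) ^ (-α)) * ENNReal.ofReal (1 / (γ + 1)) +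
        ENNReal.ofReal (2 ^ |γ|) * ∫⁻ r in Ioo (0 : ℝ) 1, ENNReal.ofReal (g r) := by
        rw [lintegral_add_left (by fun_prop), lintegral_const_mul _ (by fun_prop),
          lintegral_const_mul _ (by fun_prop), lintegral_Ioo_rpow hγ]
    _ ≤ ENNReal.ofReal (4 * (1 - x) ^ (-α)) * ENNReal.ofReal (1 / (γ + 1)) +
        ENNReal.ofReal (2 ^ |γ|) * ENNReal.ofReal ((1 / α + 1 / (1 - α)) * (1 - x) ^ (-α)) := by
        gcongr
    _ = _ := by
        rw [← ENNReal.ofReal_mul (by positivity), ← ENNReal.ofReal_mul (by positivity),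
          ← ENNReal.ofReal_add (by positivity) (by positivity), ← ENNReal.ofReal.eq_1,
          ← ENNReal.ofReal_mul' (by positivity)]
        congr 1
        ring

theorem norm_mul_conj_lt_one {w η : ℂ} (hw : ‖w‖ < 1) (hη : ‖η‖ < 1) : ‖w * conj η‖ < 1 := by
  rw [norm_mul, RCLike.norm_conj]
  nlinarith [norm_nonneg w, norm_nonneg η]

theorem one_sub_ne_zero_of_norm_lt_one {t : ℂ} (ht : ‖t‖ < 1) : 1 - t ≠ 0 := fun h => by
  rw [← sub_eq_zero.1 h] at ht
  simp at ht

/-- This is the Poisson kernel: `1 / |1 - t|²` equals `(1 - |t|²)⁻¹` times the real part of `(1 + t)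
/ (1 - t)`, a holomorphic function whose circle average is its value 1 at the centre. -/
theorem integral_one_div_norm_sq {w : ℂ} (hw : ‖w‖ < 1) {r : ℝ} (hr0 : 0 < r) (hr1 : r < 1) :
    ∫⁻ θ in Ioo (-Real.pi) Real.pi, ENNReal.ofReal (1 / ‖1 - w * conj (circleMap 0 r θ)‖ ^ 2) =
      ENNReal.ofReal (2 * Real.pi / (1 - (‖w‖ * r) ^ 2)) := by
  let F : ℂ → ℂ := fun η => (1 + conj w * η) / (1 - conj w * η)
  have hne : ∀ η : ℂ, ‖η‖ < 1 → 1 - conj w * η ≠ 0 := fun η hη =>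
    one_sub_ne_zero_of_norm_lt_one (by rw [mul_comm]; exact norm_mul_conj_lt_one hη hw)
  have hF : DifferentiableOn ℂ F (closedBall 0 r) := by
    refine DifferentiableOn.div (by fun_prop) (by fun_prop) fun η hη => hne η ?_
    rw [mem_closedBall_zero_iff] at hη
    linarith
  have hav : Real.circleAverage F 0 r = 1 := by
    have : DiffContOnCl ℂ F (ball 0 |r|) := by
      rw [abs_of_pos hr0]
      exact hF.diffContOnCl_ball Subset.rfl
    rw [this.circleAverage]
    simp [F]
  have hint := circleAverage_eq_integral_Ioo F r
  have hnorm : ∀ θ, ‖circleMap 0 r θ‖ = r := fun θ => by simp [abs_of_pos hr0]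
  have hcF : Continuous fun θ => F (circleMap 0 r θ) := by
    refine hF.continuousOn.comp_continuous (continuous_circleMap 0 r) fun θ => ?_
    simp [hnorm]
  have hFi : IntegrableOn (fun θ => F (circleMap 0 r θ)) (Ioo (-Real.pi) Real.pi) :=
    (hcF.integrableOn_Icc).mono_set Ioo_subset_Icc_self
  have hρ : 0 < 1 - (‖w‖ * r) ^ 2 := by
    have : ‖w‖ * r < 1 := by nlinarith [norm_nonneg w]
    have : 0 ≤ ‖w‖ * r := by positivity
    nlinarith
  have hre : ∀ θ, 1 / ‖1 - w * conj (circleMap 0 r θ)‖ ^ 2 =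
      (1 - (‖w‖ * r) ^ 2)⁻¹ * (F (circleMap 0 r θ)).re := by
    intro θ
    set η := circleMap 0 r θ with hη
    have hη1 : ‖η‖ < 1 := by rw [hnorm]; exact hr1
    have h1 : ‖1 - w * conj η‖ = ‖1 - conj w * η‖ := by
      rw [← RCLike.norm_conj]
      simp
    have h2 := hne η hη1
    have h3 : (F η).re = (1 - (‖w‖ * r) ^ 2) / ‖1 - conj w * η‖ ^ 2 := by
      have h4 : ‖conj w * η‖ ^ 2 = (‖w‖ * r) ^ 2 := by rw [norm_mul, RCLike.norm_conj, hnorm]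
      rw [← h4]
      simp only [F]
      rw [Complex.div_re, ← Complex.normSq_eq_norm_sq, ← Complex.normSq_eq_norm_sq, ← add_div]
      congr 1
      generalize conj w * η = t
      simp only [Complex.normSq_apply, Complex.add_re, Complex.sub_re, Complex.one_re,
        Complex.add_im, Complex.sub_im, Complex.one_im]
      ring
    rw [h3, h1, ← mul_div_assoc, inv_mul_cancel₀ hρ.ne']
  simp_rw [hre]
  rw [← ofReal_integral_eq_lintegral_ofReal]
  · congr 1
    rw [integral_const_mul]
    have h5 : ∫ θ in Ioo (-Real.pi) Real.pi, (F (circleMap 0 r θ)).re =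
        (∫ θ in Ioo (-Real.pi) Real.pi, F (circleMap 0 r θ)).re := integral_re hFi
    rw [h5, ← hint, hav]
    simp
    ring
  · exact (hFi.re).const_mul _
  · refine Eventually.of_forall fun θ => ?_
    change 0 ≤ (1 - (‖w‖ * r) ^ 2)⁻¹ * (F (circleMap 0 r θ)).re
    rw [← hre]
    positivity

/-- The angular integral is explicit, which reduces the bound to the radial estimate with `γ = κ +
1`; the extra 1 is the polar Jacobian. -/
theorem exists_lintegral_unitBall_schur_le {α κ : ℝ} (hα0 : 0 < α) (hα1 : α < 1) (hκ : -2 < κ) :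
    ∃ C : ℝ≥0, ∀ w ∈ ball (0 : ℂ) 1,
      ∫⁻ η in ball (0 : ℂ) 1,
        ENNReal.ofReal (‖η‖ ^ κ * (1 - ‖η‖) ^ (-α) * (1 / ‖1 - w * conj η‖ ^ 2)) ≤
        C * ENNReal.ofReal ((1 - ‖w‖) ^ (-α)) := by
  obtain ⟨C, hC⟩ := exists_lintegral_one_sub_rpow_le hα0 hα1 (γ := κ + 1) (by linarith)
  refine ⟨C * Real.toNNReal (2 * Real.pi), fun w hw => ?_⟩
  have hw1 : ‖w‖ < 1 := by simpa using hw
  have hm : Measurable fun η : ℂ =>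
      ENNReal.ofReal (‖η‖ ^ κ * (1 - ‖η‖) ^ (-α) * (1 / ‖1 - w * conj η‖ ^ 2)) := by
    have : Measurable fun η : ℂ => ‖1 - w * conj η‖ :=
      Continuous.measurable (by fun_prop)
    fun_prop
  rw [lintegral_unitBall_eq_polar hm]
  calc _ ≤ ∫⁻ r in Ioo (0 : ℝ) 1, ENNReal.ofReal (2 * Real.pi) *
        ENNReal.ofReal ((1 - r) ^ (-α) * r ^ (κ + 1) / (1 - ‖w‖ * r)) := by
        refine setLIntegral_mono (by fun_prop) fun r hr => ?_
        have hnorm : ∀ θ, ‖circleMap 0 r θ‖ = r := fun θ => by simp [abs_of_pos hr.1]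
        have h1 : 0 < 1 - r := by linarith [hr.2]
        have h2 : 0 < 1 - ‖w‖ * r := by nlinarith [norm_nonneg w, hr.1]
        have h3 := Real.rpow_pos_of_pos hr.1 κ
        have h4 := Real.rpow_pos_of_pos h1 (-α)
        simp only [hnorm]
        have h5 : ∀ θ, ENNReal.ofReal (r ^ κ * (1 - r) ^ (-α) *
            (1 / ‖1 - w * conj (circleMap 0 r θ)‖ ^ 2)) = ENNReal.ofReal (r ^ κ * (1 - r) ^ (-α)) *
            ENNReal.ofReal (1 / ‖1 - w * conj (circleMap 0 r θ)‖ ^ 2) := fun θ =>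
          ENNReal.ofReal_mul (by positivity)
        simp_rw [h5]
        rw [lintegral_const_mul' _ _ ENNReal.ofReal_ne_top, integral_one_div_norm_sq hw1 hr.1 hr.2,
          ← ENNReal.ofReal_mul (by positivity), ← ENNReal.ofReal_mul (by linarith [hr.1]),
          ← ENNReal.ofReal_mul (by positivity)]
        refine ENNReal.ofReal_le_ofReal ?_
        rw [Real.rpow_add_one hr.1.ne']
        have h6 : 2 * Real.pi / (1 - (‖w‖ * r) ^ 2) ≤ 2 * Real.pi / (1 - ‖w‖ * r) := by
          gcongr
          have : 0 ≤ ‖w‖ * r := mul_nonneg (norm_nonneg _) hr.1.le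
          nlinarith
        calc r * (r ^ κ * (1 - r) ^ (-α) * (2 * Real.pi / (1 - (‖w‖ * r) ^ 2)))
            ≤ r * (r ^ κ * (1 - r) ^ (-α) * (2 * Real.pi / (1 - ‖w‖ * r))) := by
              have := hr.1.le
              gcongr
          _ = _ := by ring
    _ = ENNReal.ofReal (2 * Real.pi) * ∫⁻ r in Ioo (0 : ℝ) 1,
        ENNReal.ofReal ((1 - r) ^ (-α) * r ^ (κ + 1) / (1 - ‖w‖ * r)) :=
        lintegral_const_mul' _ _ ENNReal.ofReal_ne_top
    _ ≤ ENNReal.ofReal (2 * Real.pi) * (C * ENNReal.ofReal ((1 - ‖w‖) ^ (-α))) := by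
        gcongr
        exact hC _ (norm_nonneg _) hw1
    _ = _ := by
        rw [ENNReal.coe_mul, ENNReal.ofReal]
        ring

theorem norm_diskKernel_le {q : ℝ} {t : ℂ} (ht : ‖t‖ < 1) :
    ‖diskKernel q t‖ ≤ (1 + |q|) * (1 / ‖1 - t‖ ^ 2) := by
  have h0 := one_sub_ne_zero_of_norm_lt_one ht
  have h1 : 0 < ‖1 - t‖ := norm_pos_iff.2 h0
  have h2 : ‖1 - t‖ ≤ 2 := (norm_sub_le _ _).trans (by rw [norm_one]; linarith)
  have h3 : ‖(2 / (1 - t) ^ 2 - q / (1 - t) : ℂ)‖ ≤ 2 * (1 + |q|) / ‖1 - t‖ ^ 2 := by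
    have e : (2 / (1 - t) ^ 2 - q / (1 - t) : ℂ) = (2 - q * (1 - t)) / (1 - t) ^ 2 := by
      field_simp
    rw [e, norm_div, norm_pow]
    gcongr
    refine (norm_sub_le _ _).trans ?_
    rw [norm_mul, Complex.norm_real, Real.norm_eq_abs, Complex.norm_ofNat]
    nlinarith [abs_nonneg q]
  have h4 : ‖(2 * Real.pi : ℂ)⁻¹‖ ≤ 1 / 2 := by
    rw [norm_inv, norm_mul, Complex.norm_ofNat, Complex.norm_real, Real.norm_eq_abs,
      abs_of_pos Real.pi_pos, ← one_div]
    gcongr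
    linarith [Real.pi_gt_three]
  rw [diskKernel, norm_mul]
  calc _ ≤ 1 / 2 * (2 * (1 + |q|) / ‖1 - t‖ ^ 2) := by gcongr
    _ = _ := by ring

end Estimates

/-! ### Schur's test. -/

section Schur

/-- Schur's test for an integral operator with nonnegative kernel. -/
theorem lintegral_rpow_le_of_schur {X : Type*} [MeasurableSpace X] {ν : Measure X} [SFinite ν]
    {p p' : ℝ} (hpp : p.HolderConjugate p') {K : X → X → ℝ≥0∞}
    (hK : Measurable (Function.uncurry K)) {h : X → ℝ≥0∞} (hh : Measurable h)
    (h0 : ∀ᵐ x ∂ν, h x ≠ 0) (ht : ∀ᵐ x ∂ν, h x ≠ ∞) {A B : ℝ≥0∞}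
    (hA : ∀ᵐ x ∂ν, ∫⁻ y, K x y * h y ^ p' ∂ν ≤ A * h x ^ p')
    (hB : ∀ᵐ y ∂ν, ∫⁻ x, K x y * h x ^ p ∂ν ≤ B * h y ^ p)
    {f : X → ℝ≥0∞} (hf : AEMeasurable f ν) :
    ∫⁻ x, (∫⁻ y, K x y * f y ∂ν) ^ p ∂ν ≤ A ^ (p / p') * B * ∫⁻ x, f x ^ p ∂ν := by
  have hp : 0 < p := hpp.pos
  have hp' : 0 < p' := hpp.symm.pos
  have hKx : ∀ x, Measurable (K x) := fun x => hK.comp measurable_prodMk_left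
  -- Hölder's inequality applied to the splitting `K f = (K^(1/p') h) (K^(1/p) h⁻¹ f)`.
  have hHolder : ∀ x, ∫⁻ y, K x y * f y ∂ν ≤ (∫⁻ y, K x y * h y ^ p' ∂ν) ^ (1 / p') *
      (∫⁻ y, K x y * (h y ^ (-p) * f y ^ p) ∂ν) ^ (1 / p) := by
    intro x
    calc ∫⁻ y, K x y * f y ∂ν
        = ∫⁻ y, ((fun y => K x y ^ (1 / p') * h y) * fun y => K x y ^ (1 / p) *
            ((h y)⁻¹ * f y)) y ∂ν := by
          refine lintegral_congr_ae ?_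
          filter_upwards [h0, ht] with y hy0 hyt
          have e1 : K x y = K x y ^ (1 / p') * K x y ^ (1 / p) := by
            rw [← ENNReal.rpow_add_of_nonneg _ _ (by positivity) (by positivity), one_div, one_div,
              add_comm, hpp.inv_add_inv_eq_one, ENNReal.rpow_one]
          simp only [Pi.mul_apply]
          calc K x y * f y = (K x y ^ (1 / p') * K x y ^ (1 / p)) * ((h y * (h y)⁻¹) * f y) := by
                rw [← e1, ENNReal.mul_inv_cancel hy0 hyt, one_mul]
            _ = _ := by ring
      _ ≤ _ := ENNReal.lintegral_mul_le_Lp_mul_Lq ν hpp.symm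
          (((hKx x).pow_const _).mul hh).aemeasurable
          (((hKx x).pow_const _).aemeasurable.mul (hh.inv.aemeasurable.mul hf))
      _ = _ := by
          congr 2
          · refine lintegral_congr fun y => ?_
            rw [ENNReal.mul_rpow_of_nonneg _ _ hp'.le, ← ENNReal.rpow_mul,
              one_div_mul_cancel hp'.ne', ENNReal.rpow_one]
          · refine lintegral_congr fun y => ?_
            rw [ENNReal.mul_rpow_of_nonneg _ _ hp.le, ENNReal.mul_rpow_of_nonneg _ _ hp.le,
              ← ENNReal.rpow_mul, one_div_mul_cancel hp.ne', ENNReal.rpow_one, ENNReal.inv_rpow,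
              ENNReal.rpow_neg]
  have hm2 : AEMeasurable (fun y => h y ^ (-p) * f y ^ p) ν :=
    (hh.pow_const _).aemeasurable.mul (hf.pow_const _)
  calc ∫⁻ x, (∫⁻ y, K x y * f y ∂ν) ^ p ∂ν
      ≤ ∫⁻ x, A ^ (p / p') * ∫⁻ y, h x ^ p * (K x y * (h y ^ (-p) * f y ^ p)) ∂ν ∂ν := by
        refine lintegral_mono_ae ?_
        filter_upwards [hA, ht] with x hx hxt
        calc (∫⁻ y, K x y * f y ∂ν) ^ p
            ≤ ((A * h x ^ p') ^ (1 / p') *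
              (∫⁻ y, K x y * (h y ^ (-p) * f y ^ p) ∂ν) ^ (1 / p)) ^ p := by
              refine ENNReal.rpow_le_rpow ((hHolder x).trans ?_) hp.le
              gcongr
          _ = A ^ (p / p') * (h x ^ p * ∫⁻ y, K x y * (h y ^ (-p) * f y ^ p) ∂ν) := by
              rw [ENNReal.mul_rpow_of_nonneg _ _ hp.le, ← ENNReal.rpow_mul, ← ENNReal.rpow_mul,
                one_div_mul_cancel hp.ne', ENNReal.rpow_one,
                ENNReal.mul_rpow_of_nonneg _ _ (by positivity), ← ENNReal.rpow_mul,
                one_div_mul_eq_div, mul_div_cancel₀ _ hp'.ne', mul_assoc]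
          _ = _ := by
              rw [lintegral_const_mul' _ _ (ENNReal.rpow_ne_top_of_nonneg hp.le hxt)]
    _ ≤ A ^ (p / p') * ∫⁻ x, ∫⁻ y, h x ^ p * (K x y * (h y ^ (-p) * f y ^ p)) ∂ν ∂ν := by
        rw [lintegral_const_mul'']
        refine AEMeasurable.lintegral_prod_right' (f := fun z : X × X =>
          h z.1 ^ p * (K z.1 z.2 * (h z.2 ^ (-p) * f z.2 ^ p))) ?_
        exact ((hh.comp measurable_fst).pow_const _).aemeasurable.mul
          (hK.aemeasurable.mul hm2.comp_snd)
    _ = A ^ (p / p') * ∫⁻ y, ∫⁻ x, h x ^ p * (K x y * (h y ^ (-p) * f y ^ p)) ∂ν ∂ν := by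
        rw [lintegral_lintegral_swap]
        exact ((hh.comp measurable_fst).pow_const _).aemeasurable.mul
          (hK.aemeasurable.mul hm2.comp_snd)
    _ ≤ A ^ (p / p') * ∫⁻ y, B * f y ^ p ∂ν := by
        gcongr 1
        refine lintegral_mono_ae ?_
        filter_upwards [hB, h0, ht] with y hy hy0 hyt
        have hKy : Measurable fun x => K x y := hK.comp measurable_prodMk_right
        calc ∫⁻ x, h x ^ p * (K x y * (h y ^ (-p) * f y ^ p)) ∂ν
            = ∫⁻ x, (K x y * h x ^ p) * (h y ^ (-p) * f y ^ p) ∂ν :=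
              lintegral_congr fun x => by ring
          _ = (∫⁻ x, K x y * h x ^ p ∂ν) * (h y ^ (-p) * f y ^ p) :=
              lintegral_mul_const _ (hKy.mul (hh.pow_const _))
          _ ≤ (B * h y ^ p) * (h y ^ (-p) * f y ^ p) := by gcongr
          _ = B * (h y ^ p * h y ^ (-p)) * f y ^ p := by ring
          _ = B * f y ^ p := by
              rw [← ENNReal.rpow_add _ _ hy0 hyt, add_neg_cancel, ENNReal.rpow_zero, mul_one]
    _ = _ := by
        rw [lintegral_const_mul'' _ (hf.pow_const _), mul_assoc]

end Schur

/-! ### Transfer from the Hartogs triangle to the bidisc. -/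

section Shear

/-- The measure `|η| ^ (-e) dA` on the unit disc. -/
noncomputable def diskMeasure (e : ℝ) : Measure ℂ :=
  weightedMeasure (ball (0 : ℂ) 1) fun η => ‖η‖ ^ (-e)

/-- The biholomorphism from the product of a disc and a punctured disc to the Hartogs triangle. -/
def hartogsMap (w : ℂ × ℂ) : ℂ × ℂ := (w.1 * w.2, w.2)

/-- The pull-back of the weighted measure on the Hartogs triangle to the bidisc. -/
noncomputable def bidiskMeasure (q : ℝ) : Measure (ℂ × ℂ) :=
  (diskMeasure 0).prod (diskMeasure (q + 2))

instance (e : ℝ) : SFinite (diskMeasure e) := by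
  unfold diskMeasure weightedMeasure
  infer_instance

instance (q : ℝ) : SFinite (bidiskMeasure q) := by
  unfold bidiskMeasure
  infer_instance

theorem measurable_hartogsMap : Measurable hartogsMap := by
  unfold hartogsMap
  fun_prop

theorem lintegral_diskMeasure (e : ℝ) {f : ℂ → ℝ≥0∞} (hf : Measurable f) :
    ∫⁻ η, f η ∂diskMeasure e = ∫⁻ η in ball (0 : ℂ) 1, ENNReal.ofReal (‖η‖ ^ (-e)) * f η := by
  rw [diskMeasure, weightedMeasure, lintegral_withDensity_eq_lintegral_mul _ (by fun_prop) hf]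
  rfl

theorem integral_diskMeasure (e : ℝ) (f : ℂ → ℂ) :
    ∫ η, f η ∂diskMeasure e = ∫ η in ball (0 : ℂ) 1, f η * (‖η‖ ^ (-e) : ℝ) := by
  rw [diskMeasure, weightedMeasure, integral_withDensity_eq_integral_toReal_smul (by fun_prop)
    (Eventually.of_forall fun _ => ENNReal.ofReal_lt_top)]
  refine integral_congr_ae (Eventually.of_forall fun η => ?_)
  simp only
  rw [ENNReal.toReal_ofReal (by positivity), Complex.real_smul, mul_comm]

theorem integrable_diskMeasure_iff (e : ℝ) (f : ℂ → ℂ) :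
    Integrable f (diskMeasure e) ↔ IntegrableOn (fun η => f η * (‖η‖ ^ (-e) : ℝ)) (ball 0 1) := by
  rw [diskMeasure, weightedMeasure, integrable_withDensity_iff_integrable_smul' (by fun_prop)
    (Eventually.of_forall fun _ => ENNReal.ofReal_lt_top)]
  refine integrable_congr (Eventually.of_forall fun η => ?_)
  simp only
  rw [ENNReal.toReal_ofReal (by positivity), Complex.real_smul, mul_comm]

theorem ae_diskMeasure_mem (e : ℝ) : ∀ᵐ η ∂diskMeasure e, η ∈ ball (0 : ℂ) 1 :=
  ae_mem_of_weightedMeasure measurableSet_ball _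

theorem ae_diskMeasure_ne_zero (e : ℝ) : ∀ᵐ η ∂diskMeasure e, η ≠ 0 := by
  have h : ∀ᵐ η ∂(volume.restrict (ball (0 : ℂ) 1)), η ≠ 0 :=
    ae_restrict_of_ae (by simp [ae_iff])
  exact (withDensity_absolutelyContinuous _ _).ae_le h

theorem ae_bidiskMeasure {q : ℝ} {P Q : ℂ → Prop} (hP : ∀ᵐ η ∂diskMeasure 0, P η)
    (hQ : ∀ᵐ η ∂diskMeasure (q + 2), Q η) : ∀ᵐ w ∂bidiskMeasure q, P w.1 ∧ Q w.2 :=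
  (Measure.quasiMeasurePreserving_fst.ae hP).and (Measure.quasiMeasurePreserving_snd.ae hQ)

theorem ae_bidiskMeasure_mem (q : ℝ) :
    ∀ᵐ w ∂bidiskMeasure q, w.1 ∈ ball (0 : ℂ) 1 ∧ w.2 ∈ ball (0 : ℂ) 1 ∧ w.2 ≠ 0 :=
  ae_bidiskMeasure (ae_diskMeasure_mem 0)
    ((ae_diskMeasure_mem _).and (ae_diskMeasure_ne_zero _))

theorem hartogsMap_mem {w : ℂ × ℂ} (h1 : w.1 ∈ ball (0 : ℂ) 1) (h2 : w.2 ∈ ball (0 : ℂ) 1)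
    (h0 : w.2 ≠ 0) : hartogsMap w ∈ hartogsTriangle := by
  have h0' := norm_pos_iff.2 h0
  rw [mem_ball_zero_iff] at h1 h2
  refine ⟨?_, h2⟩
  simp only [hartogsMap, norm_mul]
  nlinarith

theorem lintegral_comp_mul_right (F : ℂ → ℝ≥0∞) (hF : Measurable F) {c : ℂ} (hc : c ≠ 0) :
    ∫⁻ v, F v = ENNReal.ofReal (‖c‖ ^ 2) * ∫⁻ v, F (v * c) := by
  have hdet : LinearMap.det (LinearMap.mulLeft ℝ c) = ‖c‖ ^ 2 := by
    have := Algebra.norm_apply ℝ c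
    rw [Algebra.norm_complex_apply, Complex.normSq_eq_norm_sq] at this
    exact this.symm
  have hpos : 0 < ‖c‖ ^ 2 := by positivity
  have h := Measure.map_linearMap_addHaar_eq_smul_addHaar (volume : Measure ℂ)
    (f := LinearMap.mulLeft ℝ c) (by rw [hdet]; exact hpos.ne')
  have h2 : ∫⁻ v, F (v * c) = ENNReal.ofReal (‖c‖ ^ 2)⁻¹ * ∫⁻ v, F v := by
    rw [hdet, abs_of_pos (by positivity)] at h
    have hL : Measurable (LinearMap.mulLeft ℝ c) := (continuous_const_mul c).measurable
    rw [← smul_eq_mul, ← lintegral_smul_measure, ← h, lintegral_map hF hL]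
    simp_rw [LinearMap.mulLeft_apply, mul_comm]
  rw [h2, ← mul_assoc, ← ENNReal.ofReal_mul hpos.le, mul_inv_cancel₀ hpos.ne', ENNReal.ofReal_one,
    one_mul]

theorem isOpen_hartogsTriangle : IsOpen hartogsTriangle :=
  (isOpen_lt (f := fun z : ℂ × ℂ => ‖z.1‖) (g := fun z => ‖z.2‖) (by fun_prop) (by fun_prop)).inter
    (isOpen_lt (f := fun z : ℂ × ℂ => ‖z.2‖) (g := fun _ => 1) (by fun_prop) (by fun_prop))

/-- On the slice `z₂ = y` the substitution `z₁ = x y` contributes `|y|²`, which turns the exponent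
`-(q + 4)` into `-(q + 2)`. -/
theorem map_hartogsMap (q : ℝ) :
    (bidiskMeasure q).map hartogsMap =
      weightedMeasure hartogsTriangle (hartogsWeight (-(q + 4))) := by
  have hHm : MeasurableSet hartogsTriangle := isOpen_hartogsTriangle.measurableSet
  have hWm : Measurable fun z => ENNReal.ofReal (hartogsWeight (-(q + 4)) z) := by
    unfold hartogsWeight
    fun_prop
  refine Measure.ext_of_lintegral _ fun g hg => ?_
  rw [lintegral_map hg measurable_hartogsMap, bidiskMeasure,
    lintegral_prod_symm' _ (by exact hg.comp measurable_hartogsMap), weightedMeasure,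
    lintegral_withDensity_eq_lintegral_mul _ hWm hg, ← lintegral_indicator hHm,
    Measure.volume_eq_prod, lintegral_prod_symm' _ ((hWm.mul hg).indicator hHm)]
  have hmi : Measurable fun y : ℂ => ∫⁻ x, g (hartogsMap (x, y)) ∂diskMeasure 0 :=
    Measurable.lintegral_prod_left' (f := fun z => g (hartogsMap z)) (hg.comp measurable_hartogsMap)
  rw [lintegral_diskMeasure _ hmi, ← lintegral_indicator measurableSet_ball]
  have hne : ∀ᵐ y : ℂ, y ≠ 0 := by simp [ae_iff]
  refine lintegral_congr_ae ?_
  filter_upwards [hne] with y hy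
  have hy0 : 0 < ‖y‖ := norm_pos_iff.2 hy
  have hgy : Measurable fun x => g (hartogsMap (x, y)) :=
    (hg.comp measurable_hartogsMap).comp measurable_prodMk_right
  by_cases hy1 : y ∈ ball (0 : ℂ) 1
  · have hy1' : ‖y‖ < 1 := by simpa using hy1
    rw [indicator_of_mem hy1, lintegral_diskMeasure _ hgy, lintegral_comp_mul_right _
      (by exact ((hWm.mul hg).indicator hHm).comp measurable_prodMk_right) hy,
      ← lintegral_indicator measurableSet_ball, ← lintegral_const_mul' _ _ ENNReal.ofReal_ne_top,
      ← lintegral_const_mul' _ _ ENNReal.ofReal_ne_top]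
    refine lintegral_congr fun x => ?_
    by_cases hx : x ∈ ball (0 : ℂ) 1
    · have hmem : (x * y, y) ∈ hartogsTriangle := hartogsMap_mem (w := (x, y)) hx hy1 hy
      rw [indicator_of_mem hx, indicator_of_mem hmem]
      simp only [neg_zero, Real.rpow_zero, ENNReal.ofReal_one, one_mul, hartogsMap, Pi.mul_apply,
        hartogsWeight]
      rw [← mul_assoc, ← ENNReal.ofReal_mul (by positivity), ← Real.rpow_natCast, ← Real.rpow_add hy0]
      congr 3
      push_cast
      ring
    · have : (x * y, y) ∉ hartogsTriangle := fun h => hx (by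
        have := h.1
        simp only [norm_mul] at this
        rw [mem_ball_zero_iff]
        nlinarith)
      rw [indicator_of_notMem hx, indicator_of_notMem this]
      simp
  · rw [indicator_of_notMem hy1]
    have : ∀ x, (x, y) ∉ hartogsTriangle := fun x h => hy1 (by simpa using h.2)
    simp [this]

end Shear

/-! ### Removable singularities and the one-variable reproducing formulas. -/

section Reproducing

theorem lintegral_unitBall_radial {ψ : ℝ → ℝ≥0∞} (hψ : Measurable ψ) :
    ∫⁻ η in ball (0 : ℂ) 1, ψ ‖η‖ =
      ENNReal.ofReal (2 * Real.pi) * ∫⁻ r in Ioo (0 : ℝ) 1, ENNReal.ofReal r * ψ r := by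
  rw [lintegral_unitBall_eq_polar (by fun_prop), ← lintegral_const_mul _ (by fun_prop)]
  refine setLIntegral_congr_fun measurableSet_Ioo fun r hr => ?_
  have hnorm : ∀ θ, ‖circleMap 0 r θ‖ = r := fun θ => by simp [abs_of_pos hr.1]
  simp only [hnorm]
  rw [setLIntegral_const, Real.volume_Ioo]
  ring_nf

theorem lintegral_unitBall_rpow {κ : ℝ} (hκ : -2 < κ) :
    ∫⁻ η in ball (0 : ℂ) 1, ENNReal.ofReal (‖η‖ ^ κ) =
      ENNReal.ofReal (2 * Real.pi / (κ + 2)) := by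
  rw [lintegral_unitBall_radial (ψ := fun r => ENNReal.ofReal (r ^ κ)) (by fun_prop)]
  have : ∫⁻ r in Ioo (0 : ℝ) 1, ENNReal.ofReal r * ENNReal.ofReal (r ^ κ) =
      ∫⁻ r in Ioo (0 : ℝ) 1, ENNReal.ofReal (r ^ (κ + 1)) := by
    refine setLIntegral_congr_fun measurableSet_Ioo fun r hr => ?_
    rw [← ENNReal.ofReal_mul hr.1.le, Real.rpow_add_one hr.1.ne', mul_comm]
  rw [this, lintegral_Ioo_rpow (by linarith), ← ENNReal.ofReal_mul (by positivity)]
  ring_nf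

theorem measurable_diskKernel (q : ℝ) : Measurable (diskKernel q) := by
  unfold diskKernel
  fun_prop

theorem conj_diskKernel (q : ℝ) (t : ℂ) : conj (diskKernel q t) = diskKernel q (conj t) := by
  simp [diskKernel, map_ofNat]

theorem differentiableAt_diskKernel (q : ℝ) {t : ℂ} (ht : ‖t‖ < 1) :
    DifferentiableAt ℂ (diskKernel q) t := by
  have h := one_sub_ne_zero_of_norm_lt_one ht
  unfold diskKernel
  refine DifferentiableAt.const_mul (DifferentiableAt.sub ?_ ?_) _
  · exact DifferentiableAt.div (by fun_prop) (by fun_prop) (pow_ne_zero _ h)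
  · exact DifferentiableAt.div (by fun_prop) (by fun_prop) h

theorem norm_diskKernel_mul_conj_le {q : ℝ} {w η : ℂ} (hw : w ∈ ball (0 : ℂ) 1)
    (hη : η ∈ ball (0 : ℂ) 1) :
    ‖diskKernel q (w * conj η)‖ ≤ (1 + |q|) * (1 / (1 - ‖w‖) ^ 2) := by
  rw [mem_ball_zero_iff] at hw hη
  refine (norm_diskKernel_le (norm_mul_conj_lt_one hw hη)).trans ?_
  have h1 : 1 - ‖w‖ ≤ ‖1 - w * conj η‖ := by
    have := norm_sub_norm_le (1 : ℂ) (w * conj η)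
    rw [norm_one, norm_mul, RCLike.norm_conj] at this
    nlinarith [norm_nonneg w, norm_nonneg η]
  have h2 : 0 < 1 - ‖w‖ := by linarith
  gcongr

theorem integrableOn_diskKernel_mul {q : ℝ} {w : ℂ} (hw : w ∈ ball (0 : ℂ) 1) {g : ℂ → ℂ}
    (hg : IntegrableOn g (ball 0 1)) :
    IntegrableOn (fun η => diskKernel q (w * conj η) * g η) (ball 0 1) := by
  refine Integrable.bdd_mul hg (((measurable_diskKernel q).comp
    (show Measurable fun η => w * conj η from Continuous.measurable (by fun_prop))).aestronglyMeasurable)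
    ((ae_restrict_iff' measurableSet_ball).2
      (Eventually.of_forall fun η hη => norm_diskKernel_mul_conj_le hw hη))

theorem integral_diskKernel_zero_mul {G : ℂ → ℂ} (hG : DifferentiableOn ℂ G (ball 0 1))
    (hint : Integrable G (diskMeasure 0)) {w : ℂ} (hw : w ∈ ball (0 : ℂ) 1) :
    ∫ η, diskKernel 0 (w * conj η) * G η ∂diskMeasure 0 = G w := by
  rw [integrable_diskMeasure_iff] at hint
  rw [integral_diskMeasure]
  refine integral_diskKernel_mul (by norm_num) hG hw ?_
  simp_rw [mul_assoc]
  exact integrableOn_diskKernel_mul hw hint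

/-- The mean value inequality on the disc of radius `|w|/2` about `w`, with `1 ≤ 2|w| |η|^(-q)`
there (this uses `q ≥ 1`), bounds `|w h(w)|` by the integral of `|h| |η|^(-q)` over that disc.
Absolute continuity of the integral sends this to 0, so the singularity is removable. A simple pole
would be integrable against `|η|^(-q)` for `q < 1`. -/
theorem exists_differentiableOn_extension {q : ℝ} (hq : 1 ≤ q) {h : ℂ → ℂ}
    (hh : DifferentiableOn ℂ h (ball 0 1 \ {0}))
    (hint : IntegrableOn (fun η => h η * (‖η‖ ^ (-q) : ℝ)) (ball 0 1)) :
    ∃ H : ℂ → ℂ, DifferentiableOn ℂ H (ball 0 1) ∧ ∀ η, η ≠ 0 → H η = h η := by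
  refine ⟨_, Complex.differentiableOn_update_limUnder_of_isLittleO
    (ball_mem_nhds (0 : ℂ) one_pos) hh ?_, fun η hη => Function.update_of_ne hη _ _⟩
  set g : ℂ → ℝ≥0∞ := fun η => ‖h η * (‖η‖ ^ (-q) : ℝ)‖ₑ with hg
  have hfin : ∫⁻ η in ball (0 : ℂ) 1, g η ≠ ∞ := hint.hasFiniteIntegral.ne
  have hpt : ∀ w ∈ ball (0 : ℂ) (1 / 2) \ {0}, ‖w * h w‖ₑ ≤
      ENNReal.ofReal (8 / Real.pi) *
        ∫⁻ η in ball w (‖w‖ / 2), g η ∂(volume.restrict (ball (0 : ℂ) 1)) := by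
    intro w hw
    have hw1 : ‖w‖ < 1 / 2 := by simpa using hw.1
    have hw0 : 0 < ‖w‖ := norm_pos_iff.2 hw.2
    have hball : ∀ η ∈ ball w (‖w‖ / 2), ‖w‖ / 2 < ‖η‖ ∧ ‖η‖ < 2 * ‖w‖ := by
      intro η hη
      rw [mem_ball, dist_eq_norm] at hη
      have h1 := norm_sub_norm_le η w
      have h2 := norm_sub_norm_le w η
      rw [norm_sub_rev] at h2
      constructor <;> linarith
    have hsub : ball w (‖w‖ / 2) ⊆ ball 0 1 \ {0} := by
      intro η hη
      have := hball η hη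
      refine ⟨by rw [mem_ball_zero_iff]; linarith, ?_⟩
      rintro rfl
      rw [norm_zero] at this
      linarith
    have h1 := enorm_mul_volume_ball_le (hh.mono hsub)
    rw [Complex.volume_ball] at h1
    have h2 : ∫⁻ η in ball w (‖w‖ / 2), ‖h η‖ₑ ≤ ENNReal.ofReal (2 * ‖w‖) *
        ∫⁻ η in ball w (‖w‖ / 2), g η ∂(volume.restrict (ball (0 : ℂ) 1)) := by
      rw [Measure.restrict_restrict measurableSet_ball,
        inter_eq_self_of_subset_left (hsub.trans sdiff_subset),
        ← lintegral_const_mul' _ _ ENNReal.ofReal_ne_top]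
      refine setLIntegral_mono' measurableSet_ball fun η hη => ?_
      obtain ⟨h3, h4⟩ := hball η hη
      have h5 : 0 < ‖η‖ := by linarith
      have h6 : 1 ≤ 2 * ‖w‖ * ‖η‖ ^ (-q) := by
        have : ‖η‖ ^ (-1 : ℝ) ≤ ‖η‖ ^ (-q) :=
          Real.rpow_le_rpow_of_exponent_ge h5 (by linarith) (by linarith)
        rw [Real.rpow_neg_one] at this
        calc (1 : ℝ) = ‖η‖ * ‖η‖⁻¹ := (mul_inv_cancel₀ h5.ne').symm
          _ ≤ 2 * ‖w‖ * ‖η‖ ^ (-q) := by gcongr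
      have h7 : ‖(((‖η‖ ^ (-q) : ℝ)) : ℂ)‖ₑ = ENNReal.ofReal (‖η‖ ^ (-q)) := by
        rw [← ofReal_norm, Complex.norm_real, Real.norm_eq_abs,
          abs_of_nonneg (by positivity)]
      simp only [hg]
      rw [enorm_mul, h7, mul_left_comm, ← ENNReal.ofReal_mul (by positivity)]
      exact le_mul_of_one_le_right' (ENNReal.one_le_ofReal.2 h6)
    set I := ∫⁻ η in ball w (‖w‖ / 2), g η ∂(volume.restrict (ball (0 : ℂ) 1)) with hI
    have h8 : ‖w‖ₑ = ENNReal.ofReal ‖w‖ := (ofReal_norm w).symm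
    have h9 : ENNReal.ofReal (‖w‖ / 2) ^ 2 * NNReal.pi = ENNReal.ofReal (‖w‖ ^ 2 * Real.pi / 4) := by
      rw [← ENNReal.ofReal_pow (by positivity), ← NNReal.coe_real_pi, ← ENNReal.ofReal_coe_nnreal,
        ← ENNReal.ofReal_mul (by positivity)]
      ring_nf
    rw [h9] at h1
    have h10 := h1.trans h2
    have hpos : 0 < ‖w‖ ^ 2 * Real.pi / 4 := by positivity
    have hc0 : ENNReal.ofReal (‖w‖ ^ 2 * Real.pi / 4) ≠ 0 := (ENNReal.ofReal_pos.2 hpos).ne'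
    refine (ENNReal.mul_le_mul_iff_left hc0 ENNReal.ofReal_ne_top).1 ?_
    calc ‖w * h w‖ₑ * ENNReal.ofReal (‖w‖ ^ 2 * Real.pi / 4)
        = ENNReal.ofReal ‖w‖ * (‖h w‖ₑ * ENNReal.ofReal (‖w‖ ^ 2 * Real.pi / 4)) := by
          rw [enorm_mul, h8, mul_assoc]
      _ ≤ ENNReal.ofReal ‖w‖ * (ENNReal.ofReal (2 * ‖w‖) * I) := by gcongr
      _ = (ENNReal.ofReal (8 / Real.pi) * ENNReal.ofReal (‖w‖ ^ 2 * Real.pi / 4)) * I := by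
          rw [← mul_assoc, ← ENNReal.ofReal_mul (by positivity),
            ← ENNReal.ofReal_mul (by positivity)]
          congr 2
          field_simp
          ring
      _ = _ := by ring
  have hvol : Tendsto (fun w : ℂ => (volume.restrict (ball (0 : ℂ) 1)) (ball w (‖w‖ / 2)))
      (𝓝[≠] 0) (𝓝 0) := by
    have h1 : Tendsto (fun w : ℂ => ENNReal.ofReal (‖w‖ / 2) ^ 2 * (NNReal.pi : ℝ≥0∞))
        (𝓝[≠] 0) (𝓝 0) := by
      have h2 : Continuous fun w : ℂ => ENNReal.ofReal (‖w‖ / 2) ^ 2 * (NNReal.pi : ℝ≥0∞) :=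
        ENNReal.continuous_mul_const ENNReal.coe_ne_top |>.comp
          ((ENNReal.continuous_pow 2).comp (ENNReal.continuous_ofReal.comp (by fun_prop)))
      have h3 := h2.tendsto 0
      simp only [norm_zero, zero_div, ENNReal.ofReal_zero, ne_eq, OfNat.ofNat_ne_zero,
        not_false_eq_true, zero_pow, zero_mul] at h3
      exact h3.mono_left nhdsWithin_le_nhds
    refine tendsto_of_tendsto_of_tendsto_of_le_of_le tendsto_const_nhds h1 (fun _ => zero_le)
      fun w => ?_
    simp only
    rw [← Complex.volume_ball w]
    exact Measure.restrict_apply_le _ _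
  have hlim := tendsto_setLIntegral_zero hfin hvol
  have hlim2 : Tendsto (fun w => w * h w) (𝓝[≠] 0) (𝓝 0) := by
    rw [tendsto_zero_iff_enorm_tendsto_zero]
    have h1 := ENNReal.Tendsto.const_mul (a := ENNReal.ofReal (8 / Real.pi)) hlim
      (Or.inr ENNReal.ofReal_ne_top)
    rw [mul_zero] at h1
    refine tendsto_of_tendsto_of_tendsto_of_le_of_le' tendsto_const_nhds h1
      (Eventually.of_forall fun _ => zero_le) ?_
    have : ball (0 : ℂ) (1 / 2) \ {0} ∈ 𝓝[≠] (0 : ℂ) :=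
      sdiff_mem_nhdsWithin_compl (ball_mem_nhds _ (by norm_num)) _
    filter_upwards [this] with w hw using hpt w hw
  rw [Asymptotics.isLittleO_iff_tendsto']
  -- The criterion concerns `h w - h 0`; the value `h 0` is arbitrary but harmless, since `w * h 0`
  -- tends to 0.
  · have h1 : Tendsto (fun w : ℂ => w * h 0) (𝓝[≠] 0) (𝓝 0) := by
      have : Continuous fun w : ℂ => w * h 0 := by fun_prop
      simpa using (this.tendsto 0).mono_left nhdsWithin_le_nhds
    have h2 := hlim2.sub h1
    rw [sub_zero] at h2
    refine h2.congr fun w => ?_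
    rw [sub_zero, div_inv_eq_mul]
    ring
  · filter_upwards [self_mem_nhdsWithin] with w hw h0
    rw [sub_zero, inv_eq_zero] at h0
    exact absurd h0 hw

/-- From `conj η |η|^(-(q+2)) = η⁻¹ |η|^(-q)`, the integral is `w` times the `|η|^(-q)` reproducing
integral of `G(η) / η`, which extends holomorphically across 0. -/
theorem integral_mul_diskKernel_mul {q : ℝ} (hq1 : 1 ≤ q) (hq2 : q < 2) {G : ℂ → ℂ}
    (hG : DifferentiableOn ℂ G (ball 0 1 \ {0}))
    (hint : Integrable (fun η => conj η * G η) (diskMeasure (q + 2))) {w : ℂ}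
    (hw : w ∈ ball (0 : ℂ) 1) (hw0 : w ≠ 0) :
    ∫ η, w * conj η * diskKernel q (w * conj η) * G η ∂diskMeasure (q + 2) = G w := by
  have hwt : ∀ η : ℂ, η ≠ 0 → conj η * ((‖η‖ ^ (-(q + 2)) : ℝ) : ℂ) = η⁻¹ * (‖η‖ ^ (-q) : ℝ) := by
    intro η hη
    have h0 : 0 < ‖η‖ := norm_pos_iff.2 hη
    rw [neg_add, Real.rpow_add h0, Real.rpow_neg h0.le 2, Real.rpow_two, Complex.ofReal_mul,
      Complex.ofReal_inv, Complex.ofReal_pow, ← Complex.mul_conj']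
    have : conj η ≠ 0 := (map_ne_zero _).2 hη
    field_simp
  have hae : ∀ᵐ η ∂(volume.restrict (ball (0 : ℂ) 1)), η ≠ 0 :=
    ae_restrict_of_ae (by simp [ae_iff])
  rw [integrable_diskMeasure_iff] at hint
  have hint2 : IntegrableOn (fun η => (G η * η⁻¹) * (‖η‖ ^ (-q) : ℝ)) (ball 0 1) := by
    refine hint.congr ?_
    filter_upwards [hae] with η hη
    rw [mul_right_comm, hwt η hη]
    ring
  obtain ⟨H, hH, hHG⟩ := exists_differentiableOn_extension hq1
    (hG.mul (differentiableOn_id.inv fun η hη => hη.2)) hint2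
  have hint3 : IntegrableOn (fun η => H η * (‖η‖ ^ (-q) : ℝ)) (ball 0 1) := by
    refine hint2.congr ?_
    filter_upwards [hae] with η hη
    rw [hHG η hη]
    rfl
  have hrep := integral_diskKernel_mul hq2 hH hw (by
    simp_rw [mul_assoc]
    exact integrableOn_diskKernel_mul hw hint3)
  rw [integral_diskMeasure]
  calc _ = ∫ η in ball (0 : ℂ) 1, w * (diskKernel q (w * conj η) * H η * (‖η‖ ^ (-q) : ℝ)) := by
        refine integral_congr_ae ?_
        filter_upwards [hae] with η hη
        rw [hHG η hη]
        simp only [Pi.mul_apply, Pi.inv_apply]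
        linear_combination (w * diskKernel q (w * conj η) * G η) * hwt η hη
    _ = G w := by
        rw [integral_const_mul, hrep, hHG w hw0]
        simp only [Pi.mul_apply, Pi.inv_apply]
        field_simp

end Reproducing

/-! ### The projection as an integral operator on the bidisc. -/

section Projection

/-- The Bergman kernel of the Hartogs triangle in the coordinates of the bidisc. -/
noncomputable def bidiskKernel (q : ℝ) (w η : ℂ × ℂ) : ℂ :=
  diskKernel 0 (w.1 * conj η.1) * (w.2 * conj η.2 * diskKernel q (w.2 * conj η.2))

/-- The inverse of `hartogsMap`. -/
noncomputable def hartogsInv (z : ℂ × ℂ) : ℂ × ℂ := (z.1 / z.2, z.2)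

/-- The measure `|z₂| ^ (-(q + 4)) dV` on the Hartogs triangle. -/
noncomputable abbrev hartogsMeasure (q : ℝ) : Measure (ℂ × ℂ) :=
  weightedMeasure hartogsTriangle (hartogsWeight (-(q + 4)))

theorem hartogsInv_hartogsMap {w : ℂ × ℂ} (h : w.2 ≠ 0) : hartogsInv (hartogsMap w) = w := by
  simp [hartogsInv, hartogsMap, h]

theorem measurable_bidiskKernel (q : ℝ) : Measurable (Function.uncurry (bidiskKernel q)) := by
  have h1 : Measurable fun x : (ℂ × ℂ) × (ℂ × ℂ) => x.1.1 * conj x.2.1 :=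
    Continuous.measurable (by fun_prop)
  have h2 : Measurable fun x : (ℂ × ℂ) × (ℂ × ℂ) => x.1.2 * conj x.2.2 :=
    Continuous.measurable (by fun_prop)
  exact ((measurable_diskKernel 0).comp h1).mul (h2.mul ((measurable_diskKernel q).comp h2))

theorem exists_norm_bidiskKernel_le {q : ℝ} {w : ℂ × ℂ} (h1 : w.1 ∈ ball (0 : ℂ) 1)
    (h2 : w.2 ∈ ball (0 : ℂ) 1) :
    ∃ C : ℝ, ∀ η : ℂ × ℂ, η.1 ∈ ball (0 : ℂ) 1 → η.2 ∈ ball (0 : ℂ) 1 →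
      ‖bidiskKernel q w η‖ ≤ C * ‖conj η.2‖ := by
  refine ⟨(1 + |0|) * (1 / (1 - ‖w.1‖) ^ 2) * (1 * ((1 + |q|) * (1 / (1 - ‖w.2‖) ^ 2))),
    fun η hη1 hη2 => ?_⟩
  have e1 := norm_diskKernel_mul_conj_le (q := 0) h1 hη1
  have e2 := norm_diskKernel_mul_conj_le (q := q) h2 hη2
  rw [mem_ball_zero_iff] at h2
  rw [bidiskKernel, norm_mul, norm_mul, norm_mul]
  calc _ ≤ (1 + |0|) * (1 / (1 - ‖w.1‖) ^ 2) *
        (1 * ‖conj η.2‖ * ((1 + |q|) * (1 / (1 - ‖w.2‖) ^ 2))) := by gcongr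
    _ = _ := by ring

/-- The kernel at a fixed point is bounded by a multiple of `|η₂|`, so this puts it in `L²`. The
integral reduces to that of `|η|^(-q)` over the disc, finite for `q < 2`. -/
theorem memLp_conj_snd {q : ℝ} (hq : q < 2) :
    MemLp (fun η : ℂ × ℂ => conj η.2) 2 (bidiskMeasure q) := by
  refine ⟨(Continuous.aestronglyMeasurable (by fun_prop)), ?_⟩
  rw [eLpNorm_lt_top_iff_lintegral_rpow_enorm_lt_top (by norm_num) (by norm_num)]
  simp only [ENNReal.toReal_ofNat]
  have e : ∫⁻ η, ‖conj η.2‖ₑ ^ (2 : ℝ) ∂bidiskMeasure q =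
      (∫⁻ _, 1 ∂diskMeasure 0) * ∫⁻ η, ‖η‖ₑ ^ (2 : ℝ) ∂diskMeasure (q + 2) := by
    rw [bidiskMeasure, ← lintegral_prod_mul (by fun_prop) (by fun_prop)]
    refine lintegral_congr fun η => ?_
    rw [one_mul, RCLike.enorm_conj]
  have h1 : ∫⁻ _, 1 ∂diskMeasure 0 < ∞ := by
    rw [lintegral_diskMeasure _ measurable_const]
    simp
  have h2 : ∫⁻ η, ‖η‖ₑ ^ (2 : ℝ) ∂diskMeasure (q + 2) < ∞ := by
    rw [lintegral_diskMeasure _ (by fun_prop)]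
    refine lt_of_eq_of_lt (setLIntegral_congr_fun_ae (g := fun η => ENNReal.ofReal (‖η‖ ^ (-q)))
      measurableSet_ball ?_) ?_
    · have hne : ∀ᵐ η : ℂ, η ≠ 0 := by simp [ae_iff]
      filter_upwards [hne] with η hη _
      have h0 : 0 < ‖η‖ := norm_pos_iff.2 hη
      rw [← ofReal_norm, ENNReal.ofReal_rpow_of_pos h0, ← ENNReal.ofReal_mul (by positivity),
        ← Real.rpow_add h0]
      congr 2
      ring
    · rw [lintegral_unitBall_rpow (by linarith)]
      exact ENNReal.ofReal_lt_top
  rw [e]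
  exact ENNReal.mul_lt_top h1 h2

/-- The reproducing property of the kernel on the product of a disc and a punctured disc. -/
theorem ae_integral_bidiskKernel_mul {q : ℝ} (hq1 : 1 ≤ q) (hq2 : q < 2) {G : ℂ × ℂ → ℂ}
    (hG : DifferentiableOn ℂ G (ball 0 1 ×ˢ (ball 0 1 \ {0})))
    (hint : Integrable (fun η : ℂ × ℂ => conj η.2 * G η) (bidiskMeasure q)) :
    ∀ᵐ w ∂bidiskMeasure q, ∫ η, bidiskKernel q w η * G η ∂bidiskMeasure q = G w := by
  have hG1 : ∀ y ∈ ball (0 : ℂ) 1, y ≠ 0 → DifferentiableOn ℂ (fun x => G (x, y)) (ball 0 1) :=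
    fun y hy hy0 => hG.comp (by fun_prop) fun x hx => ⟨hx, hy, hy0⟩
  have hG2 : ∀ x ∈ ball (0 : ℂ) 1, DifferentiableOn ℂ (fun y => G (x, y)) (ball 0 1 \ {0}) :=
    fun x hx => hG.comp (by fun_prop) fun y hy => ⟨hx, hy⟩
  have hint' := hint
  rw [bidiskMeasure] at hint'
  have hslice := hint'.prod_left_ae
  have hslice2 := hint'.prod_right_ae
  filter_upwards [ae_bidiskMeasure (ae_diskMeasure_mem 0)
    ((ae_diskMeasure_mem _).and ((ae_diskMeasure_ne_zero _).and hslice))] with w hw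
  obtain ⟨hw1, hw2, hw0, hws⟩ := hw
  have hcw : conj w.2 ≠ 0 := (map_ne_zero _).2 hw0
  have hGw : Integrable (fun x => G (x, w.2)) (diskMeasure 0) := by
    have := hws.const_mul (conj w.2)⁻¹
    refine this.congr (Eventually.of_forall fun x => ?_)
    simp only
    field_simp
  have hm1 : Measurable fun η : ℂ × ℂ => w.1 * conj η.1 := Continuous.measurable (by fun_prop)
  have hm2 : Measurable fun η : ℂ × ℂ => w.2 * conj η.2 := Continuous.measurable (by fun_prop)
  -- The factor `conj η.2` stays with `G`, since only their product is assumed integrable; the rest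
  -- of the kernel is bounded for fixed `w`.
  have hbd : Integrable (fun η : ℂ × ℂ => bidiskKernel q w η * G η) (bidiskMeasure q) := by
    have hb := Integrable.bdd_mul
      (c := (1 + |0|) * (1 / (1 - ‖w.1‖) ^ 2) * (‖w.2‖ * ((1 + |q|) * (1 / (1 - ‖w.2‖) ^ 2))))
      (f := fun η : ℂ × ℂ =>
      diskKernel 0 (w.1 * conj η.1) * (w.2 * diskKernel q (w.2 * conj η.2))) hint
      (((measurable_diskKernel 0).comp hm1).mul
        (((measurable_diskKernel q).comp hm2).const_mul _)).aestronglyMeasurable ?_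
    · refine hb.congr (Eventually.of_forall fun η => ?_)
      simp only [bidiskKernel]
      ring
    · filter_upwards [ae_bidiskMeasure_mem q] with η hη
      have e1 := norm_diskKernel_mul_conj_le (q := 0) hw1 hη.1
      have e2 := norm_diskKernel_mul_conj_le (q := q) hw2 hη.2.1
      rw [norm_mul, norm_mul]
      gcongr
  rw [bidiskMeasure] at hbd ⊢
  rw [integral_prod _ hbd]
  calc _ = ∫ x, diskKernel 0 (w.1 * conj x) * G (x, w.2) ∂diskMeasure 0 := by
        refine integral_congr_ae ?_
        filter_upwards [ae_diskMeasure_mem 0, hslice2] with x hx hxs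
        rw [← integral_mul_diskKernel_mul hq1 hq2 (hG2 x hx) hxs hw2 hw0, ← integral_const_mul]
        refine integral_congr_ae (Eventually.of_forall fun y => ?_)
        simp only [bidiskKernel]
        ring
    _ = G w := integral_diskKernel_zero_mul (hG1 _ hw2 hw0) hGw hw1

theorem hartogsInv_mem {z : ℂ × ℂ} (hz : z ∈ hartogsTriangle) :
    (hartogsInv z).1 ∈ ball (0 : ℂ) 1 ∧ (hartogsInv z).2 ∈ ball (0 : ℂ) 1 ∧ z.2 ≠ 0 := by
  have h0 : 0 < ‖z.2‖ := (norm_nonneg _).trans_lt hz.1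
  refine ⟨?_, by simpa [hartogsInv] using hz.2, norm_pos_iff.1 h0⟩
  simp only [hartogsInv, mem_ball_zero_iff, norm_div]
  rw [div_lt_one h0]
  exact hz.1

theorem memLp_comp_hartogsMap {q : ℝ} {p : ℝ≥0∞} {f : ℂ × ℂ → ℂ}
    (hf : AEStronglyMeasurable f (hartogsMeasure q)) :
    MemLp f p (hartogsMeasure q) ↔ MemLp (fun w => f (hartogsMap w)) p (bidiskMeasure q) := by
  rw [hartogsMeasure, ← map_hartogsMap] at hf ⊢
  exact memLp_map_measure_iff hf measurable_hartogsMap.aemeasurable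

theorem eLpNorm_comp_hartogsMap {q : ℝ} {p : ℝ≥0∞} {f : ℂ × ℂ → ℂ}
    (hf : AEStronglyMeasurable f (hartogsMeasure q)) :
    eLpNorm f p (hartogsMeasure q) = eLpNorm (fun w => f (hartogsMap w)) p (bidiskMeasure q) := by
  rw [hartogsMeasure, ← map_hartogsMap] at hf ⊢
  exact eLpNorm_map_measure hf measurable_hartogsMap.aemeasurable

theorem integral_comp_hartogsMap {q : ℝ} {f : ℂ × ℂ → ℂ}
    (hf : AEStronglyMeasurable f (hartogsMeasure q)) :
    ∫ z, f z ∂hartogsMeasure q = ∫ w, f (hartogsMap w) ∂bidiskMeasure q := by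
  rw [hartogsMeasure, ← map_hartogsMap] at hf ⊢
  exact integral_map measurable_hartogsMap.aemeasurable hf

theorem ae_comp_hartogsMap {q : ℝ} {P : ℂ × ℂ → Prop} (h : ∀ᵐ z ∂hartogsMeasure q, P z) :
    ∀ᵐ w ∂bidiskMeasure q, P (hartogsMap w) := by
  rw [hartogsMeasure, ← map_hartogsMap] at h
  exact ae_of_ae_map measurable_hartogsMap.aemeasurable h

/-- The kernel of the Hartogs triangle at a fixed point, as a holomorphic function. -/
noncomputable def hartogsKernel (q : ℝ) (w z : ℂ × ℂ) : ℂ :=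
  conj (bidiskKernel q w (hartogsInv z))

theorem measurable_hartogsKernel (q : ℝ) (w : ℂ × ℂ) : Measurable (hartogsKernel q w) := by
  have h1 : Measurable hartogsInv := by
    unfold hartogsInv
    fun_prop
  exact Complex.continuous_conj.measurable.comp
    (((measurable_bidiskKernel q).comp measurable_prodMk_left).comp h1)

theorem memLp_hartogsKernel {q : ℝ} (hq : q < 2) {w : ℂ × ℂ} (h1 : w.1 ∈ ball (0 : ℂ) 1)
    (h2 : w.2 ∈ ball (0 : ℂ) 1) : MemLp (hartogsKernel q w) 2 (hartogsMeasure q) := by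
  have hm := measurable_hartogsKernel q w
  rw [memLp_comp_hartogsMap hm.aestronglyMeasurable]
  obtain ⟨C, hC⟩ := exists_norm_bidiskKernel_le (q := q) h1 h2
  refine (memLp_conj_snd hq).of_le_mul (c := C)
    (hm.comp measurable_hartogsMap).aestronglyMeasurable ?_
  filter_upwards [ae_bidiskMeasure_mem q] with η hη
  rw [hartogsKernel, hartogsInv_hartogsMap hη.2.2, RCLike.norm_conj]
  exact hC η hη.1 hη.2.1

theorem differentiableOn_hartogsKernel {q : ℝ} {w : ℂ × ℂ} (h1 : w.1 ∈ ball (0 : ℂ) 1)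
    (h2 : w.2 ∈ ball (0 : ℂ) 1) : DifferentiableOn ℂ (hartogsKernel q w) hartogsTriangle := by
  have he : hartogsKernel q w = fun z : ℂ × ℂ => diskKernel 0 (conj w.1 * (z.1 / z.2)) *
      (conj w.2 * z.2 * diskKernel q (conj w.2 * z.2)) := by
    funext z
    simp [hartogsKernel, bidiskKernel, hartogsInv, conj_diskKernel]
  rw [he]
  intro z hz
  obtain ⟨hz1, hz2, hz0⟩ := hartogsInv_mem hz
  rw [mem_ball_zero_iff] at h1 h2 hz1 hz2
  have e1 := differentiableAt_diskKernel 0 (t := conj w.1 * (z.1 / z.2)) (by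
    rw [mul_comm]; exact norm_mul_conj_lt_one hz1 h1)
  have e2 := differentiableAt_diskKernel q (t := conj w.2 * z.2) (by
    rw [mul_comm]; exact norm_mul_conj_lt_one hz2 h2)
  have d1 : DifferentiableAt ℂ (fun z : ℂ × ℂ => conj w.1 * (z.1 / z.2)) z := by
    simp_rw [div_eq_mul_inv]
    exact (differentiableAt_fst.mul (differentiableAt_snd.inv hz0)).const_mul _
  have d2 : DifferentiableAt ℂ (fun z : ℂ × ℂ => conj w.2 * z.2) z :=
    differentiableAt_snd.const_mul _
  exact ((e1.comp z d1).mul (d2.mul (e2.comp z d2))).differentiableWithinAt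

theorem inner_hartogsKernel {q : ℝ} {w : ℂ × ℂ}
    (hk : MemLp (hartogsKernel q w) 2 (hartogsMeasure q)) (u : Lp ℂ 2 (hartogsMeasure q)) :
    inner ℂ (hk.toLp _) u =
      ∫ η, bidiskKernel q w η * u (hartogsMap η) ∂bidiskMeasure q := by
  have hu : AEStronglyMeasurable (fun z => u z * conj (hartogsKernel q w z)) (hartogsMeasure q) :=
    (Lp.aestronglyMeasurable u).mul (Complex.continuous_conj.comp_aestronglyMeasurable hk.1)
  rw [L2.inner_def]
  calc _ = ∫ z, u z * conj (hartogsKernel q w z) ∂hartogsMeasure q := by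
        refine integral_congr_ae ?_
        filter_upwards [hk.coeFn_toLp] with z hz
        rw [hz, RCLike.inner_apply]
    _ = ∫ η, u (hartogsMap η) * conj (hartogsKernel q w (hartogsMap η)) ∂bidiskMeasure q :=
        integral_comp_hartogsMap hu
    _ = _ := by
        refine integral_congr_ae ?_
        filter_upwards [ae_bidiskMeasure_mem q] with η hη
        rw [hartogsKernel, hartogsInv_hartogsMap hη.2.2, Complex.conj_conj, mul_comm]

/-- The weighted Bergman projection of the Hartogs triangle as an integral operator. -/
theorem ae_bergmanProjection_eq_integral {q : ℝ} (hq1 : 1 ≤ q) (hq2 : q < 2)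
    (f : Lp ℂ 2 (hartogsMeasure q)) :
    ∀ᵐ w ∂bidiskMeasure q,
      bergmanProjection hartogsTriangle (hartogsWeight (-(q + 4))) f (hartogsMap w) =
        ∫ η, bidiskKernel q w η * f (hartogsMap η) ∂bidiskMeasure q := by
  set B := bergmanProjection hartogsTriangle (hartogsWeight (-(q + 4))) with hB
  have hmem : B f ∈ bergmanSpace hartogsTriangle (hartogsWeight (-(q + 4))) :=
    Submodule.starProjection_apply_mem _ f
  obtain ⟨g, hg, hBg⟩ := hmem
  have hBg' := ae_comp_hartogsMap hBg
  have hB2 : MemLp (fun w => B f (hartogsMap w)) 2 (bidiskMeasure q) :=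
    (memLp_comp_hartogsMap (Lp.aestronglyMeasurable _)).1 (Lp.memLp (B f))
  have hG2 : MemLp (fun w => g (hartogsMap w)) 2 (bidiskMeasure q) := hB2.ae_eq hBg'
  have hGd : DifferentiableOn ℂ (fun w => g (hartogsMap w)) (ball 0 1 ×ˢ (ball 0 1 \ {0})) := by
    refine hg.comp ?_ fun w hw => hartogsMap_mem hw.1 hw.2.1 hw.2.2
    unfold hartogsMap
    fun_prop
  -- The measure is infinite near `w₂ = 0`, so square integrability does not make `G` integrable;
  -- its product with `conj w₂`, also in `L²`, is integrable.
  have hint := (memLp_conj_snd hq2).integrable_mul hG2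
  filter_upwards [ae_integral_bidiskKernel_mul hq1 hq2 hGd hint, hBg', ae_bidiskMeasure_mem q]
    with w h1 h2 h3
  have hk := memLp_hartogsKernel hq2 h3.1 h3.2.1
  have hkm : hk.toLp _ ∈ bergmanSpace hartogsTriangle (hartogsWeight (-(q + 4))) :=
    ⟨_, differentiableOn_hartogsKernel h3.1 h3.2.1, hk.coeFn_toLp⟩
  rw [h2, ← h1, ← inner_hartogsKernel hk f]
  -- With `k` the kernel at `w`, the value of `B f` there is `⟨k, B f⟩ = ⟨B k, f⟩ = ⟨k, f⟩`: the
  -- reproducing property, self-adjointness, and `k` in the Bergman space.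
  calc _ = ∫ η, bidiskKernel q w η * B f (hartogsMap η) ∂bidiskMeasure q := by
        refine integral_congr_ae ?_
        filter_upwards [hBg'] with η hη
        rw [hη]
    _ = inner ℂ (hk.toLp _) (B f) := (inner_hartogsKernel hk _).symm
    _ = inner ℂ (B (hk.toLp _)) f :=
        (Submodule.inner_starProjection_left_eq_right _ _ _).symm
    _ = _ := by
        rw [show B (hk.toLp _) = hk.toLp _ from Submodule.starProjection_eq_self_iff.2 hkm]

end Projection

/-! ### Sufficiency: boundedness by Schur's test. -/

section Bounded

/-- A positive kernel dominating the Bergman kernel on the bidisc. -/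
noncomputable def schurKernel (w η : ℂ × ℂ) : ℝ≥0∞ :=
  ENNReal.ofReal (1 / ‖1 - w.1 * conj η.1‖ ^ 2) *
    ENNReal.ofReal (‖w.2‖ * ‖η.2‖ * (1 / ‖1 - w.2 * conj η.2‖ ^ 2))

/-- The family of test functions for Schur's test. -/
noncomputable def schurWeight (σ : ℝ) (w : ℂ × ℂ) : ℝ≥0∞ :=
  ENNReal.ofReal ((1 - ‖w.1‖) ^ (-(σ / 2))) *
    ENNReal.ofReal ((1 - ‖w.2‖) ^ (-(σ / 2)) * ‖w.2‖ ^ σ)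

theorem measurable_schurKernel : Measurable (Function.uncurry schurKernel) := by
  have h1 : Measurable fun x : (ℂ × ℂ) × (ℂ × ℂ) => ‖1 - x.1.1 * conj x.2.1‖ :=
    Continuous.measurable (by fun_prop)
  have h2 : Measurable fun x : (ℂ × ℂ) × (ℂ × ℂ) => ‖1 - x.1.2 * conj x.2.2‖ :=
    Continuous.measurable (by fun_prop)
  unfold schurKernel Function.uncurry
  fun_prop

theorem measurable_schurWeight (σ : ℝ) : Measurable (schurWeight σ) := by
  unfold schurWeight
  fun_prop

theorem norm_one_sub_mul_conj_comm (w η : ℂ) : ‖1 - w * conj η‖ = ‖1 - η * conj w‖ := by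
  rw [← RCLike.norm_conj]
  simp [mul_comm]

theorem schurKernel_comm (w η : ℂ × ℂ) : schurKernel w η = schurKernel η w := by
  simp only [schurKernel, norm_one_sub_mul_conj_comm w.1, norm_one_sub_mul_conj_comm w.2,
    mul_comm ‖w.2‖]

theorem schurWeight_rpow {σ s : ℝ} (hs : 0 ≤ s) {w : ℂ × ℂ} (h1 : w.1 ∈ ball (0 : ℂ) 1)
    (h2 : w.2 ∈ ball (0 : ℂ) 1) : schurWeight σ w ^ s = schurWeight (σ * s) w := by
  rw [mem_ball_zero_iff] at h1 h2
  have e1 : 0 ≤ 1 - ‖w.1‖ := by linarith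
  have e2 : 0 ≤ 1 - ‖w.2‖ := by linarith
  rw [schurWeight, schurWeight, ENNReal.mul_rpow_of_nonneg _ _ hs,
    ENNReal.ofReal_rpow_of_nonneg (by positivity) hs,
    ENNReal.ofReal_rpow_of_nonneg (by positivity) hs,
    Real.mul_rpow (by positivity) (by positivity), ← Real.rpow_mul e1, ← Real.rpow_mul e2,
    ← Real.rpow_mul (norm_nonneg _)]
  ring_nf

theorem schurWeight_ne_zero {σ : ℝ} {w : ℂ × ℂ} (h1 : w.1 ∈ ball (0 : ℂ) 1)
    (h2 : w.2 ∈ ball (0 : ℂ) 1) (h0 : w.2 ≠ 0) : schurWeight σ w ≠ 0 := by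
  rw [mem_ball_zero_iff] at h1 h2
  have e1 : 0 < 1 - ‖w.1‖ := by linarith
  have e2 : 0 < 1 - ‖w.2‖ := by linarith
  have e3 : 0 < ‖w.2‖ := norm_pos_iff.2 h0
  exact mul_ne_zero (ENNReal.ofReal_pos.2 (by positivity)).ne'
    (ENNReal.ofReal_pos.2 (by positivity)).ne'

theorem schurWeight_ne_top (σ : ℝ) (w : ℂ × ℂ) : schurWeight σ w ≠ ∞ :=
  ENNReal.mul_ne_top ENNReal.ofReal_ne_top ENNReal.ofReal_ne_top

/-- The integral factors into two disc integrals. In the second variable the powers of `|η|` combine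
to `σ - q - 1`, which exceeds -2 exactly when `σ > q - 1`, and the kernel's factor `|w₂|` is at most
`|w₂|^σ` because `σ ≤ 1`. Taking `σ/2` as boundary exponent keeps it in `(0, 1)` even for `σ = 1`.
-/
theorem exists_lintegral_schurKernel_le {q σ : ℝ} (hσ0 : 0 < σ) (hσq : q - 1 < σ) (hσ1 : σ ≤ 1) :
    ∃ C : ℝ≥0, ∀ w : ℂ × ℂ, w.1 ∈ ball (0 : ℂ) 1 → w.2 ∈ ball (0 : ℂ) 1 → w.2 ≠ 0 →
      ∫⁻ η, schurKernel w η * schurWeight σ η ∂bidiskMeasure q ≤ C * schurWeight σ w := by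
  obtain ⟨C₁, hC₁⟩ := exists_lintegral_unitBall_schur_le (α := σ / 2) (κ := 0) (by linarith)
    (by linarith) (by norm_num)
  obtain ⟨C₂, hC₂⟩ := exists_lintegral_unitBall_schur_le (α := σ / 2) (κ := σ - q - 1)
    (by linarith) (by linarith) (by linarith)
  refine ⟨C₁ * C₂, fun w h1 h2 h0 => ?_⟩
  have hm : ∀ w : ℂ, Measurable fun η : ℂ => ‖1 - w * conj η‖ := fun w =>
    Continuous.measurable (by fun_prop)
  have hm1 := hm w.1
  have hm2 := hm w.2
  have hw2 : ‖w.2‖ < 1 := by simpa using h2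
  have hw0 : 0 < ‖w.2‖ := norm_pos_iff.2 h0
  have b1 : ∫⁻ η, ENNReal.ofReal (1 / ‖1 - w.1 * conj η‖ ^ 2) *
      ENNReal.ofReal ((1 - ‖η‖) ^ (-(σ / 2))) ∂diskMeasure 0 ≤
      C₁ * ENNReal.ofReal ((1 - ‖w.1‖) ^ (-(σ / 2))) := by
    refine le_trans (le_of_eq ?_) (hC₁ w.1 h1)
    rw [lintegral_diskMeasure _ (by fun_prop)]
    refine setLIntegral_congr_fun measurableSet_ball fun η hη => ?_
    rw [mem_ball_zero_iff] at hη
    have : 0 ≤ 1 - ‖η‖ := by linarith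
    rw [← ENNReal.ofReal_mul (by positivity), ← ENNReal.ofReal_mul (by positivity)]
    simp only [neg_zero, Real.rpow_zero]
    ring_nf
  have b2 : ∫⁻ η, ENNReal.ofReal (‖w.2‖ * ‖η‖ * (1 / ‖1 - w.2 * conj η‖ ^ 2)) *
      ENNReal.ofReal ((1 - ‖η‖) ^ (-(σ / 2)) * ‖η‖ ^ σ) ∂diskMeasure (q + 2) ≤
      C₂ * ENNReal.ofReal ((1 - ‖w.2‖) ^ (-(σ / 2)) * ‖w.2‖ ^ σ) := by
    have hne : ∀ᵐ η : ℂ, η ≠ 0 := by simp [ae_iff]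
    rw [lintegral_diskMeasure _ (by fun_prop)]
    calc _ = ∫⁻ η in ball (0 : ℂ) 1, ENNReal.ofReal ‖w.2‖ * ENNReal.ofReal
          (‖η‖ ^ (σ - q - 1) * (1 - ‖η‖) ^ (-(σ / 2)) * (1 / ‖1 - w.2 * conj η‖ ^ 2)) := by
          refine setLIntegral_congr_fun_ae measurableSet_ball ?_
          filter_upwards [hne] with η hη0 hη
          rw [mem_ball_zero_iff] at hη
          have e1 : 0 ≤ 1 - ‖η‖ := by linarith
          have e0 : 0 < ‖η‖ := norm_pos_iff.2 hη0
          rw [← ENNReal.ofReal_mul (by positivity), ← ENNReal.ofReal_mul (by positivity),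
            ← ENNReal.ofReal_mul (by positivity)]
          congr 1
          rw [show σ - q - 1 = -(q + 2) + 1 + σ by ring, Real.rpow_add e0, Real.rpow_add e0,
            Real.rpow_one]
          ring
      _ = ENNReal.ofReal ‖w.2‖ * ∫⁻ η in ball (0 : ℂ) 1, ENNReal.ofReal
          (‖η‖ ^ (σ - q - 1) * (1 - ‖η‖) ^ (-(σ / 2)) * (1 / ‖1 - w.2 * conj η‖ ^ 2)) :=
          lintegral_const_mul' _ _ ENNReal.ofReal_ne_top
      _ ≤ ENNReal.ofReal (‖w.2‖ ^ σ) * (C₂ * ENNReal.ofReal ((1 - ‖w.2‖) ^ (-(σ / 2)))) := by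
          gcongr
          · calc ‖w.2‖ = ‖w.2‖ ^ (1 : ℝ) := (Real.rpow_one _).symm
              _ ≤ _ := Real.rpow_le_rpow_of_exponent_ge hw0 hw2.le hσ1
          · exact hC₂ w.2 h2
      _ = _ := by
          rw [ENNReal.ofReal_mul' (by positivity)]
          ring
  calc _ = ∫⁻ η, (ENNReal.ofReal (1 / ‖1 - w.1 * conj η.1‖ ^ 2) *
          ENNReal.ofReal ((1 - ‖η.1‖) ^ (-(σ / 2)))) *
        (ENNReal.ofReal (‖w.2‖ * ‖η.2‖ * (1 / ‖1 - w.2 * conj η.2‖ ^ 2)) *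
          ENNReal.ofReal ((1 - ‖η.2‖) ^ (-(σ / 2)) * ‖η.2‖ ^ σ)) ∂bidiskMeasure q := by
        refine lintegral_congr fun η => ?_
        simp only [schurKernel, schurWeight]
        ring
    _ = _ := by
        rw [bidiskMeasure, lintegral_prod_mul (f := fun η : ℂ =>
          ENNReal.ofReal (1 / ‖1 - w.1 * conj η‖ ^ 2) * ENNReal.ofReal ((1 - ‖η‖) ^ (-(σ / 2))))
          (g := fun η : ℂ => ENNReal.ofReal (‖w.2‖ * ‖η‖ * (1 / ‖1 - w.2 * conj η‖ ^ 2)) *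
          ENNReal.ofReal ((1 - ‖η‖) ^ (-(σ / 2)) * ‖η‖ ^ σ)) (by fun_prop) (by fun_prop)]
    _ ≤ (C₁ * ENNReal.ofReal ((1 - ‖w.1‖) ^ (-(σ / 2)))) *
        (C₂ * ENNReal.ofReal ((1 - ‖w.2‖) ^ (-(σ / 2)) * ‖w.2‖ ^ σ)) := by gcongr
    _ = _ := by
        rw [schurWeight, ENNReal.coe_mul]
        ring

theorem exists_lintegral_schurKernel_rpow_le {q c s : ℝ} (hs : 0 < s) (hc : 0 < c)
    (hq : q - 1 < c * s) (h1 : c * s ≤ 1) :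
    ∃ C : ℝ≥0, ∀ᵐ w ∂bidiskMeasure q,
      ∫⁻ η, schurKernel w η * schurWeight c η ^ s ∂bidiskMeasure q ≤ C * schurWeight c w ^ s := by
  obtain ⟨C, hC⟩ := exists_lintegral_schurKernel_le (mul_pos hc hs) hq h1
  refine ⟨C, ?_⟩
  filter_upwards [ae_bidiskMeasure_mem q] with w hw
  rw [schurWeight_rpow hs.le hw.1 hw.2.1]
  refine le_trans (le_of_eq (lintegral_congr_ae ?_)) (hC w hw.1 hw.2.1 hw.2.2)
  filter_upwards [ae_bidiskMeasure_mem q] with η hη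
  rw [schurWeight_rpow hs.le hη.1 hη.2.1]

theorem enorm_bidiskKernel_le {q : ℝ} {w η : ℂ × ℂ} (hw1 : w.1 ∈ ball (0 : ℂ) 1)
    (hw2 : w.2 ∈ ball (0 : ℂ) 1) (hη1 : η.1 ∈ ball (0 : ℂ) 1) (hη2 : η.2 ∈ ball (0 : ℂ) 1) :
    ‖bidiskKernel q w η‖ₑ ≤ ENNReal.ofReal (1 + |q|) * schurKernel w η := by
  rw [mem_ball_zero_iff] at hw1 hw2 hη1 hη2
  have e1 := norm_diskKernel_le (q := 0) (norm_mul_conj_lt_one hw1 hη1)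
  have e2 := norm_diskKernel_le (q := q) (norm_mul_conj_lt_one hw2 hη2)
  rw [abs_zero, add_zero, one_mul] at e1
  rw [schurKernel, ← ENNReal.ofReal_mul (by positivity), ← ENNReal.ofReal_mul (by positivity),
    ← ofReal_norm, bidiskKernel, norm_mul, norm_mul, norm_mul, RCLike.norm_conj]
  refine ENNReal.ofReal_le_ofReal ?_
  calc _ ≤ 1 / ‖1 - w.1 * conj η.1‖ ^ 2 *
        (‖w.2‖ * ‖η.2‖ * ((1 + |q|) * (1 / ‖1 - w.2 * conj η.2‖ ^ 2))) := by gcongr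
    _ = _ := by ring

theorem bergmanProjectionLpBounded_of_lt {q p : ℝ} (hq1 : 1 ≤ q) (hq2 : q < 2) (hqp : q < p)
    (hpq : p * q < p + q) :
    BergmanProjectionLpBounded hartogsTriangle (hartogsWeight (-(q + 4))) p := by
  have hp1 : 1 < p := by linarith
  have hp0 : 0 < p := by linarith
  have hpp : p.HolderConjugate (p / (p - 1)) := Real.HolderConjugate.conjExponent hp1
  set p' := p / (p - 1) with hp'
  have hp1' : 0 < p - 1 := by linarith
  have hp'0 : 0 < p' := hpp.symm.pos
  -- Take `c = 1 / max p p'`. The larger of `c p`, `c p'` is then 1, and the smaller is `p - 1` or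
  -- `1 / (p - 1)`; that it exceeds `q - 1` is `q < p` or `p q < p + q` respectively.
  obtain ⟨c, hc, h1, h2, h3, h4⟩ : ∃ c : ℝ, 0 < c ∧ q - 1 < c * p ∧ c * p ≤ 1 ∧ q - 1 < c * p' ∧
      c * p' ≤ 1 := by
    rcases le_total p p' with h | h
    · refine ⟨1 / p', by positivity, ?_, ?_, ?_, ?_⟩
      · have : 1 / p' * p = p - 1 := by rw [hp']; field_simp
        linarith
      · rw [one_div_mul_eq_div, div_le_one hp'0]
        exact h
      · rw [one_div_mul_cancel hp'0.ne']
        linarith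
      · rw [one_div_mul_cancel hp'0.ne']
    · refine ⟨1 / p, by positivity, ?_, ?_, ?_, ?_⟩
      · rw [one_div_mul_cancel hp0.ne']
        linarith
      · rw [one_div_mul_cancel hp0.ne']
      · have : 1 / p * p' = 1 / (p - 1) := by rw [hp']; field_simp
        rw [this, lt_div_iff₀ hp1']
        nlinarith
      · rw [one_div_mul_eq_div, div_le_one hp0]
        exact h
  obtain ⟨A, hA⟩ := exists_lintegral_schurKernel_rpow_le hp'0 hc h3 h4
  obtain ⟨B, hB⟩ := exists_lintegral_schurKernel_rpow_le hp0 hc h1 h2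
  set N : ℝ≥0 := (1 + |q|).toNNReal ^ p * (A ^ (p / p') * B) with hN
  refine ⟨N ^ (1 / p), fun f hf => ?_⟩
  have hofp0 : ENNReal.ofReal p ≠ 0 := (ENNReal.ofReal_pos.2 hp0).ne'
  rw [eLpNorm_comp_hartogsMap (Lp.aestronglyMeasurable _),
    eLpNorm_comp_hartogsMap (Lp.aestronglyMeasurable _),
    eLpNorm_eq_lintegral_rpow_enorm_toReal hofp0 ENNReal.ofReal_ne_top,
    eLpNorm_eq_lintegral_rpow_enorm_toReal hofp0 ENNReal.ofReal_ne_top,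
    ENNReal.toReal_ofReal hp0.le]
  have hfm : AEMeasurable (fun w => ‖f (hartogsMap w)‖ₑ) (bidiskMeasure q) :=
    ((memLp_comp_hartogsMap (Lp.aestronglyMeasurable _)).1 (Lp.memLp f)).1.enorm
  have hSchur := lintegral_rpow_le_of_schur hpp measurable_schurKernel (measurable_schurWeight c)
    (ν := bidiskMeasure q) (by
      filter_upwards [ae_bidiskMeasure_mem q] with w hw
      exact schurWeight_ne_zero hw.1 hw.2.1 hw.2.2)
    (Eventually.of_forall fun w => schurWeight_ne_top c w) hA (B := B) (by
      filter_upwards [hB] with w hw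
      simp_rw [schurKernel_comm _ w]
      exact hw) hfm
  have hmain : ∫⁻ w, ‖bergmanProjection hartogsTriangle (hartogsWeight (-(q + 4))) f
      (hartogsMap w)‖ₑ ^ p ∂bidiskMeasure q ≤
      N * ∫⁻ w, ‖f (hartogsMap w)‖ₑ ^ p ∂bidiskMeasure q := by
    calc _ ≤ ∫⁻ w, ENNReal.ofReal (1 + |q|) ^ p *
          (∫⁻ η, schurKernel w η * ‖f (hartogsMap η)‖ₑ ∂bidiskMeasure q) ^ p ∂bidiskMeasure q := by
          refine lintegral_mono_ae ?_
          filter_upwards [ae_bergmanProjection_eq_integral hq1 hq2 f, ae_bidiskMeasure_mem q]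
            with w hw hwm
          rw [hw, ← ENNReal.mul_rpow_of_nonneg _ _ hp0.le]
          refine ENNReal.rpow_le_rpow ?_ hp0.le
          refine (enorm_integral_le_lintegral_enorm _).trans ?_
          rw [← lintegral_const_mul' _ _ ENNReal.ofReal_ne_top]
          refine lintegral_mono_ae ?_
          filter_upwards [ae_bidiskMeasure_mem q] with η hη
          rw [enorm_mul, ← mul_assoc]
          gcongr
          exact enorm_bidiskKernel_le hwm.1 hwm.2.1 hη.1 hη.2.1
      _ = ENNReal.ofReal (1 + |q|) ^ p * ∫⁻ w,
          (∫⁻ η, schurKernel w η * ‖f (hartogsMap η)‖ₑ ∂bidiskMeasure q) ^ p ∂bidiskMeasure q :=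
          lintegral_const_mul' _ _ (ENNReal.rpow_ne_top_of_nonneg hp0.le ENNReal.ofReal_ne_top)
      _ ≤ ENNReal.ofReal (1 + |q|) ^ p * ((A : ℝ≥0∞) ^ (p / p') * B *
          ∫⁻ w, ‖f (hartogsMap w)‖ₑ ^ p ∂bidiskMeasure q) := by gcongr
      _ = _ := by
          rw [hN, ENNReal.coe_mul, ENNReal.coe_mul, ENNReal.coe_rpow_of_nonneg _ hp0.le,
            ENNReal.coe_rpow_of_nonneg _ (by positivity), ENNReal.ofReal]
          ring
  rw [ENNReal.coe_rpow_of_nonneg _ (by positivity),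
    ← ENNReal.mul_rpow_of_nonneg _ _ (by positivity)]
  exact ENNReal.rpow_le_rpow hmain (by positivity)

end Bounded

/-! ### Necessity: test functions and their projections. -/

section Unbounded

/-- The truncated integral of a power. -/
noncomputable def powerIntegral (e δ : ℝ) : ℝ≥0∞ := ∫⁻ r in Ioo δ 1, ENNReal.ofReal (r ^ e)

/-- The power `r ^ τ`, cut off at `δ`. -/
noncomputable def cutoffPow (δ τ r : ℝ) : ℝ := if δ < r then r ^ τ else 0

theorem measurable_cutoffPow (δ τ : ℝ) : Measurable (cutoffPow δ τ) :=
  Measurable.ite measurableSet_Ioi (by fun_prop) measurable_const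

theorem cutoffPow_nonneg (δ τ : ℝ) {r : ℝ} (hr : 0 ≤ r) : 0 ≤ cutoffPow δ τ r := by
  unfold cutoffPow
  split_ifs <;> positivity

theorem neg_log_le_powerIntegral {e δ : ℝ} (he : e ≤ -1) (hδ0 : 0 < δ) (hδ1 : δ < 1) :
    ENNReal.ofReal (-Real.log δ) ≤ powerIntegral e δ := by
  have h := lintegral_Ioo_eq_ofReal_sub hδ1.le (F := Real.log) (f := fun r => r⁻¹)
    (Real.continuousOn_log.mono fun r hr => (hδ0.trans_le hr.1).ne')
    (fun r hr => Real.hasDerivAt_log (hδ0.trans hr.1).ne')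
    (fun r hr => inv_nonneg.2 (hδ0.trans hr.1).le)
  rw [Real.log_one, zero_sub] at h
  rw [← h]
  refine setLIntegral_mono (by fun_prop) fun r hr => ENNReal.ofReal_le_ofReal ?_
  rw [← Real.rpow_neg_one]
  exact Real.rpow_le_rpow_of_exponent_ge (hδ0.trans hr.1) hr.2.le he

theorem powerIntegral_mono (e : ℝ) {δ δ' : ℝ} (h : δ ≤ δ') :
    powerIntegral e δ' ≤ powerIntegral e δ :=
  lintegral_mono_set (Ioo_subset_Ioo_left h)

theorem powerIntegral_zero_eq_top {e : ℝ} (he : e ≤ -1) : powerIntegral e 0 = ∞ := by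
  refine ENNReal.eq_top_of_forall_nnreal_le fun N => ?_
  have h1 : Real.exp (-((N : ℝ) + 1)) < 1 := by
    rw [Real.exp_lt_one_iff]
    linarith [N.coe_nonneg]
  have h2 := neg_log_le_powerIntegral he (Real.exp_pos _) h1
  rw [Real.log_exp, neg_neg] at h2
  refine le_trans ?_ (h2.trans (powerIntegral_mono e (Real.exp_pos _).le))
  rw [← ENNReal.ofReal_coe_nnreal]
  exact ENNReal.ofReal_le_ofReal (by linarith)

theorem powerIntegral_ne_top (e : ℝ) {δ : ℝ} (hδ : 0 < δ) : powerIntegral e δ ≠ ∞ := by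
  refine ne_top_of_le_ne_top (b := ∫⁻ _ in Ioo δ 1, ENNReal.ofReal (δ ^ (-|e|))) ?_ ?_
  · rw [setLIntegral_const, Real.volume_Ioo]
    exact ENNReal.mul_ne_top ENNReal.ofReal_ne_top ENNReal.ofReal_ne_top
  · refine setLIntegral_mono measurable_const fun r hr => ENNReal.ofReal_le_ofReal ?_
    have hr0 := hδ.trans hr.1
    calc r ^ e ≤ r ^ (-|e|) := Real.rpow_le_rpow_of_exponent_ge hr0 hr.2.le (neg_abs_le e)
      _ ≤ _ := Real.rpow_le_rpow_of_nonpos hδ hr.1.le (by simp)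

theorem powerIntegral_ne_zero (e : ℝ) {δ : ℝ} (hδ : 0 < δ) (hδ1 : δ < 1) :
    powerIntegral e δ ≠ 0 := by
  refine (lt_of_lt_of_le (b := ∫⁻ _ in Ioo δ 1, ENNReal.ofReal (δ ^ |e|)) ?_ ?_).ne'
  · rw [setLIntegral_const, Real.volume_Ioo]
    have : 0 < 1 - δ := by linarith
    exact ENNReal.mul_pos (ENNReal.ofReal_pos.2 (by positivity)).ne' (ENNReal.ofReal_pos.2 this).ne'
  · refine setLIntegral_mono (by fun_prop) fun r hr => ENNReal.ofReal_le_ofReal ?_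
    have hr0 := hδ.trans hr.1
    calc δ ^ |e| ≤ r ^ |e| := Real.rpow_le_rpow hδ.le hr.1.le (abs_nonneg e)
      _ ≤ r ^ e := Real.rpow_le_rpow_of_exponent_ge hr0 hr.2.le (le_abs_self e)

theorem lintegral_cutoffPow {δ : ℝ} (hδ : 0 ≤ δ) (a τ s : ℝ) (hs : 0 < s) :
    ∫⁻ r in Ioo (0 : ℝ) 1, ENNReal.ofReal (r ^ a) * ENNReal.ofReal (cutoffPow δ τ r) ^ s =
      powerIntegral (a + τ * s) δ := by
  have h : Ioi δ ∩ Ioo (0 : ℝ) 1 = Ioo δ 1 := by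
    ext r
    simp only [mem_inter_iff, mem_Ioi, mem_Ioo]
    exact ⟨fun h => ⟨h.1, h.2.2⟩, fun h => ⟨h.1, hδ.trans_lt h.1, h.2⟩⟩
  rw [powerIntegral, ← h, ← setLIntegral_indicator measurableSet_Ioi]
  refine setLIntegral_congr_fun measurableSet_Ioo fun r hr => ?_
  by_cases hr1 : δ < r
  · rw [indicator_of_mem (by exact hr1), cutoffPow, if_pos hr1,
      ENNReal.ofReal_rpow_of_nonneg (Real.rpow_nonneg hr.1.le _) hs.le, ← Real.rpow_mul hr.1.le,
      ← ENNReal.ofReal_mul (Real.rpow_nonneg hr.1.le _), ← Real.rpow_add hr.1]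
  · rw [indicator_of_notMem (by exact hr1), cutoffPow, if_neg hr1, ENNReal.ofReal_zero,
      ENNReal.zero_rpow_of_pos hs, mul_zero]

/-- The function `z₂ |z₂| ^ τ`, cut off at `|z₂| = δ`. -/
noncomputable def testFunction (δ τ : ℝ) (z : ℂ × ℂ) : ℂ := z.2 * (cutoffPow δ τ ‖z.2‖ : ℝ)

theorem measurable_testFunction (δ τ : ℝ) : Measurable (testFunction δ τ) := by
  have := measurable_cutoffPow δ τ
  unfold testFunction
  fun_prop

theorem lintegral_testFunction {q δ τ p : ℝ} (hδ : 0 ≤ δ) (hp : 0 < p) :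
    ∫⁻ w, ‖testFunction δ τ (hartogsMap w)‖ₑ ^ p ∂bidiskMeasure q =
      (∫⁻ _, 1 ∂diskMeasure 0) * ENNReal.ofReal (2 * Real.pi) *
        powerIntegral ((1 + τ) * p - q - 1) δ := by
  have hm := measurable_cutoffPow δ τ
  calc _ = ∫⁻ w, 1 * (ENNReal.ofReal ‖w.2‖ * ENNReal.ofReal (cutoffPow δ τ ‖w.2‖)) ^ p
        ∂bidiskMeasure q := by
        refine lintegral_congr fun w => ?_
        rw [testFunction, hartogsMap, one_mul, enorm_mul, ← ofReal_norm, ← ofReal_norm,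
          Complex.norm_real, Real.norm_eq_abs, abs_of_nonneg (cutoffPow_nonneg _ _ (norm_nonneg _))]
    _ = (∫⁻ _, 1 ∂diskMeasure 0) * ∫⁻ η,
          (ENNReal.ofReal ‖η‖ * ENNReal.ofReal (cutoffPow δ τ ‖η‖)) ^ p ∂diskMeasure (q + 2) := by
        rw [bidiskMeasure, lintegral_prod_mul (f := fun _ => 1) (g := fun η : ℂ =>
          (ENNReal.ofReal ‖η‖ * ENNReal.ofReal (cutoffPow δ τ ‖η‖)) ^ p) (by fun_prop)
          (by fun_prop)]
    _ = _ := by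
        rw [lintegral_diskMeasure (q + 2) (by fun_prop), lintegral_unitBall_radial (ψ := fun r =>
          ENNReal.ofReal (r ^ (-(q + 2))) *
            (ENNReal.ofReal r * ENNReal.ofReal (cutoffPow δ τ r)) ^ p) (by fun_prop), mul_assoc,
          show (1 + τ) * p - q - 1 = (p - q - 1) + τ * p by ring, ← lintegral_cutoffPow hδ _ _ _ hp]
        congr 2
        refine setLIntegral_congr_fun measurableSet_Ioo fun r hr => ?_
        have h0 := hr.1.le
        rw [ENNReal.mul_rpow_of_nonneg _ _ hp.le, ← mul_assoc, ← mul_assoc,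
          ENNReal.ofReal_rpow_of_nonneg h0 hp.le, ← ENNReal.ofReal_mul h0,
          ← ENNReal.ofReal_mul (by positivity)]
        congr 2
        rw [show p - q - 1 = 1 + -(q + 2) + p by ring, Real.rpow_add hr.1, Real.rpow_add hr.1,
          Real.rpow_one]

theorem lintegral_one_diskMeasure_ne_top : ∫⁻ _, 1 ∂diskMeasure 0 ≠ ∞ := by
  rw [lintegral_diskMeasure _ measurable_const]
  simp

theorem lintegral_one_diskMeasure_ne_zero : ∫⁻ _, 1 ∂diskMeasure 0 ≠ 0 := by
  rw [lintegral_diskMeasure _ measurable_const]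
  simp [NNReal.pi_ne_zero]

theorem eLpNorm_testFunction {q δ τ p : ℝ} (hδ : 0 ≤ δ) (hp : 0 < p) :
    eLpNorm (testFunction δ τ) (ENNReal.ofReal p) (hartogsMeasure q) =
      ((∫⁻ _, 1 ∂diskMeasure 0) * ENNReal.ofReal (2 * Real.pi)) ^ (1 / p) *
        powerIntegral ((1 + τ) * p - q - 1) δ ^ (1 / p) := by
  rw [eLpNorm_comp_hartogsMap (measurable_testFunction _ _).aestronglyMeasurable,
    eLpNorm_eq_lintegral_rpow_enorm_toReal (ENNReal.ofReal_pos.2 hp).ne' ENNReal.ofReal_ne_top,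
    ENNReal.toReal_ofReal hp.le, lintegral_testFunction hδ hp,
    ENNReal.mul_rpow_of_nonneg _ _ (by positivity)]

theorem memLp_testFunction (q τ : ℝ) {δ p : ℝ} (hδ : 0 < δ) (hp : 0 < p) :
    MemLp (testFunction δ τ) (ENNReal.ofReal p) (hartogsMeasure q) := by
  refine ⟨(measurable_testFunction _ _).aestronglyMeasurable, ?_⟩
  rw [eLpNorm_testFunction hδ.le hp]
  exact ENNReal.mul_lt_top (ENNReal.rpow_lt_top_of_nonneg (by positivity) (ENNReal.mul_ne_top
    lintegral_one_diskMeasure_ne_top ENNReal.ofReal_ne_top))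
    (ENNReal.rpow_lt_top_of_nonneg (by positivity) (powerIntegral_ne_top _ hδ))

theorem lintegral_mul_cutoffPow (q τ : ℝ) {δ : ℝ} (hδ : 0 ≤ δ) :
    ∫⁻ r in Ioo (0 : ℝ) 1, ENNReal.ofReal (r * (r ^ (-q) * cutoffPow δ τ r)) =
      powerIntegral (1 + τ - q) δ := by
  have h := lintegral_cutoffPow hδ (1 - q) τ 1 one_pos
  rw [show 1 - q + τ * 1 = 1 + τ - q by ring] at h
  rw [← h]
  refine setLIntegral_congr_fun measurableSet_Ioo fun r hr => ?_
  rw [ENNReal.rpow_one, ← ENNReal.ofReal_mul (Real.rpow_nonneg hr.1.le _), ← mul_assoc,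
    sub_eq_add_neg (1 : ℝ), Real.rpow_add hr.1, Real.rpow_one]

/-- The Bergman projection maps the test functions to multiples of `z₂`. -/
theorem bergmanProjection_testFunction {q δ : ℝ} (hq1 : 1 ≤ q) (hq2 : q < 2) (τ : ℝ) (hδ : 0 < δ)
    {f : Lp ℂ 2 (hartogsMeasure q)} (hf : f =ᵐ[hartogsMeasure q] testFunction δ τ) :
    ∃ c : ℂ, ‖c‖ₑ = ENNReal.ofReal (2 - q) * powerIntegral (1 + τ - q) δ ∧
      ∀ᵐ w ∂bidiskMeasure q,
        bergmanProjection hartogsTriangle (hartogsWeight (-(q + 4))) f (hartogsMap w) =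
          c * testFunction 0 0 (hartogsMap w) := by
  have hcut := measurable_cutoffPow δ τ
  set ψ : ℝ → ℝ := fun r => r ^ (-q) * cutoffPow δ τ r with hψ
  have hψm : Measurable ψ := by fun_prop
  have hψ0 : ∀ r, 0 ≤ r → 0 ≤ ψ r := fun r hr =>
    mul_nonneg (Real.rpow_nonneg hr _) (cutoffPow_nonneg _ _ hr)
  have hE := lintegral_mul_cutoffPow q τ hδ.le
  have hEfin := powerIntegral_ne_top (1 + τ - q) hδ
  have hI : ENNReal.ofReal (∫ r in Ioo (0 : ℝ) 1, r * ψ r) = powerIntegral (1 + τ - q) δ := by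
    rw [← hE, ofReal_integral_eq_lintegral_ofReal]
    · refine ⟨by fun_prop, ?_⟩
      rw [HasFiniteIntegral]
      refine lt_of_eq_of_lt (setLIntegral_congr_fun measurableSet_Ioo fun r hr => ?_)
        (hE ▸ hEfin.lt_top)
      exact Real.enorm_eq_ofReal (mul_nonneg hr.1.le (hψ0 r hr.1.le))
    · exact (ae_restrict_iff' measurableSet_Ioo).2
        (Eventually.of_forall fun r hr => mul_nonneg hr.1.le (hψ0 r hr.1.le))
  refine ⟨((2 - q) * ∫ r in Ioo (0 : ℝ) 1, r * ψ r : ℝ), ?_, ?_⟩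
  · have : 0 ≤ (2 - q) * ∫ r in Ioo (0 : ℝ) 1, r * ψ r :=
      mul_nonneg (by linarith) (setIntegral_nonneg measurableSet_Ioo fun r hr =>
        mul_nonneg hr.1.le (hψ0 r hr.1.le))
    rw [← ofReal_norm, Complex.norm_real, Real.norm_eq_abs, abs_of_nonneg this,
      ENNReal.ofReal_mul (by linarith), hI]
  have hψint : IntegrableOn (fun η : ℂ => ((ψ ‖η‖ : ℝ) : ℂ)) (ball 0 1) := by
    refine ⟨(Complex.measurable_ofReal.comp (hψm.comp measurable_norm)).aestronglyMeasurable, ?_⟩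
    rw [HasFiniteIntegral]
    have h1 : ∀ η : ℂ, ‖((ψ ‖η‖ : ℝ) : ℂ)‖ₑ = ENNReal.ofReal (ψ ‖η‖) := fun η => by
      rw [← ofReal_norm, Complex.norm_real, Real.norm_eq_abs,
        abs_of_nonneg (hψ0 _ (norm_nonneg _))]
    simp_rw [h1]
    rw [lintegral_unitBall_radial (ψ := fun r => ENNReal.ofReal (ψ r)) (by fun_prop)]
    refine ENNReal.mul_lt_top ENNReal.ofReal_lt_top ?_
    refine lt_of_eq_of_lt (setLIntegral_congr_fun measurableSet_Ioo fun r hr => ?_)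
      (hE ▸ hEfin.lt_top)
    rw [← ENNReal.ofReal_mul hr.1.le]
  have hone : Integrable (fun _ : ℂ => (1 : ℂ)) (diskMeasure 0) := by
    rw [integrable_diskMeasure_iff]
    simp
  filter_upwards [ae_bergmanProjection_eq_integral hq1 hq2 f, ae_bidiskMeasure_mem q] with w hw hwm
  have h1 := integral_diskKernel_zero_mul (G := fun _ => 1) (differentiableOn_const _) hone hwm.1
  have h2 := integral_diskKernel_mul_radial (q := q) hwm.2.1
    (integrableOn_diskKernel_mul hwm.2.1 hψint)
  have hne : ∀ᵐ η : ℂ, η ≠ 0 := by simp [ae_iff]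
  rw [hw]
  calc _ = ∫ η, diskKernel 0 (w.1 * conj η.1) * 1 * (w.2 * conj η.2 *
          diskKernel q (w.2 * conj η.2) * (η.2 * (cutoffPow δ τ ‖η.2‖ : ℝ))) ∂bidiskMeasure q := by
        refine integral_congr_ae ?_
        filter_upwards [ae_comp_hartogsMap hf] with η hη
        rw [hη, bidiskKernel, testFunction, hartogsMap]
        ring
    _ = ∫ η, w.2 * conj η *
          diskKernel q (w.2 * conj η) * (η * (cutoffPow δ τ ‖η‖ : ℝ)) ∂diskMeasure (q + 2) := by
        rw [bidiskMeasure, integral_prod_mul (fun η : ℂ => diskKernel 0 (w.1 * conj η) * 1)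
          (fun η : ℂ => w.2 * conj η * diskKernel q (w.2 * conj η) *
            (η * (cutoffPow δ τ ‖η‖ : ℝ))), h1, one_mul]
    -- The factor `η` of the test function meets `conj η` of the kernel, so apart from `diskKernel`
    -- the integrand is radial.
    _ = w.2 * ∫ η in ball (0 : ℂ) 1, diskKernel q (w.2 * conj η) * (ψ ‖η‖ : ℝ) := by
        rw [integral_diskMeasure, ← integral_const_mul]
        refine integral_congr_ae (ae_restrict_of_ae ?_)
        filter_upwards [hne] with η hη
        have h0 : 0 < ‖η‖ := norm_pos_iff.2 hη
        have h3 : ‖η‖ ^ (-q) = ‖η‖ ^ 2 * ‖η‖ ^ (-(q + 2)) := by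
          rw [← Real.rpow_two, ← Real.rpow_add h0]
          ring_nf
        simp only [hψ, h3]
        push_cast
        rw [← Complex.mul_conj']
        ring
    _ = _ := by
        rw [h2, testFunction, hartogsMap, cutoffPow, if_pos (norm_pos_iff.2 hwm.2.2),
          Real.rpow_zero, Complex.ofReal_one, mul_one, mul_comm]

/-- Both sides are norms of multiples of cut-off powers, with a common finite nonzero constant that
cancels. The power integral at 0 is the norm of `z₂` (`δ = τ = 0`), possibly infinite. -/
theorem exists_powerIntegral_le_of_bounded {q p : ℝ} (hq1 : 1 ≤ q) (hq2 : q < 2) (hp : 0 < p)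
    (h : BergmanProjectionLpBounded hartogsTriangle (hartogsWeight (-(q + 4))) p) :
    ∃ C : ℝ≥0, ∀ τ δ : ℝ, 0 < δ →
      ENNReal.ofReal (2 - q) * powerIntegral (1 + τ - q) δ * powerIntegral (p - q - 1) 0 ^ (1 / p) ≤
        C * powerIntegral ((1 + τ) * p - q - 1) δ ^ (1 / p) := by
  obtain ⟨C, hC⟩ := h
  refine ⟨C, fun τ δ hδ => ?_⟩
  have h2 : MemLp (testFunction δ τ) 2 (hartogsMeasure q) := by
    simpa using memLp_testFunction q τ hδ (p := 2) (by norm_num)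
  have hf := h2.coeFn_toLp
  have hb := hC (h2.toLp _) ((memLp_testFunction q τ hδ hp).ae_eq hf.symm)
  obtain ⟨c, hc, hcw⟩ := bergmanProjection_testFunction hq1 hq2 τ hδ hf
  rw [eLpNorm_congr_ae hf, eLpNorm_testFunction hδ.le hp,
    eLpNorm_comp_hartogsMap (Lp.aestronglyMeasurable _), eLpNorm_congr_ae hcw] at hb
  have e1 : eLpNorm (fun w => c * testFunction 0 0 (hartogsMap w)) (ENNReal.ofReal p)
      (bidiskMeasure q) = ‖c‖ₑ * eLpNorm (testFunction 0 0) (ENNReal.ofReal p) (hartogsMeasure q) := by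
    rw [eLpNorm_comp_hartogsMap (measurable_testFunction _ _).aestronglyMeasurable]
    exact eLpNorm_const_smul c (fun w => testFunction 0 0 (hartogsMap w)) _ _
  rw [e1, eLpNorm_testFunction le_rfl hp, hc, add_zero, one_mul] at hb
  set K := ((∫⁻ _, 1 ∂diskMeasure 0) * ENNReal.ofReal (2 * Real.pi)) ^ (1 / p) with hK
  have hpi : ENNReal.ofReal (2 * Real.pi) ≠ 0 := (ENNReal.ofReal_pos.2 (by positivity)).ne'
  have hKt : K ≠ ∞ := ENNReal.rpow_ne_top_of_nonneg (by positivity)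
    (ENNReal.mul_ne_top lintegral_one_diskMeasure_ne_top ENNReal.ofReal_ne_top)
  have hK0 : K ≠ 0 := (ENNReal.rpow_pos (ENNReal.mul_pos lintegral_one_diskMeasure_ne_zero hpi)
    (ENNReal.mul_ne_top lintegral_one_diskMeasure_ne_top ENNReal.ofReal_ne_top)).ne'
  refine (ENNReal.mul_le_mul_iff_right hK0 hKt).1 ?_
  calc _ = ENNReal.ofReal (2 - q) * powerIntegral (1 + τ - q) δ *
        (K * powerIntegral (p - q - 1) 0 ^ (1 / p)) := by ring
    _ ≤ _ := hb
    _ = _ := by ring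

/-- For `p ≤ q` the function `z₂` has infinite norm, yet a nonzero multiple of it is the projection
of a cut-off function in `L² ∩ Lᵖ`. -/
theorem lt_of_bergmanProjectionLpBounded {q p : ℝ} (hq1 : 1 ≤ q) (hq2 : q < 2) (hp : 0 < p)
    (h : BergmanProjectionLpBounded hartogsTriangle (hartogsWeight (-(q + 4))) p) : q < p := by
  by_contra! hle
  obtain ⟨C, hC⟩ := exists_powerIntegral_le_of_bounded hq1 hq2 hp h
  have h1 := hC 0 (1 / 2) (by norm_num)
  rw [powerIntegral_zero_eq_top (by linarith), ENNReal.top_rpow_of_pos (by positivity),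
    ENNReal.mul_top] at h1
  · refine absurd (top_le_iff.1 h1) (ENNReal.mul_ne_top ENNReal.coe_ne_top ?_)
    exact ENNReal.rpow_ne_top_of_nonneg (by positivity) (powerIntegral_ne_top _ (by norm_num))
  · exact mul_ne_zero (ENNReal.ofReal_pos.2 (by linarith)).ne'
      (powerIntegral_ne_zero _ (by norm_num) (by norm_num))

/-- For `τ = p' - 2` the projection coefficient and the `p`-th power of the norm of the test
function involve the same integral `E(δ)` of `r^(p'-q-1)`. Boundedness gives `E ≲ E^(1/p)`, hence a
bound on `E` uniform in `δ`, while `p' ≤ q` makes `E` diverge at least logarithmically. -/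
theorem mul_lt_add_of_bergmanProjectionLpBounded {q p : ℝ} (hq1 : 1 ≤ q) (hq2 : q < 2)
    (hp : 1 < p) (h : BergmanProjectionLpBounded hartogsTriangle (hartogsWeight (-(q + 4))) p) :
    p * q < p + q := by
  by_contra! hle
  have hp0 : 0 < p := by linarith
  have hp1 : 0 < p - 1 := by linarith
  obtain ⟨C, hC⟩ := exists_powerIntegral_le_of_bounded hq1 hq2 hp0 h
  set p' := p / (p - 1) with hp'
  have hp'q : p' ≤ q := by
    rw [hp', div_le_iff₀ hp1]
    linarith
  have e1 : (1 + (p' - 2)) * p - q - 1 = p' - q - 1 := by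
    rw [hp']
    field_simp
    ring
  set Z := ENNReal.ofReal (2 - q) * powerIntegral (p - q - 1) 0 ^ (1 / p) with hZ
  have hz : powerIntegral (p - q - 1) 0 ≠ 0 := fun h0 =>
    powerIntegral_ne_zero (p - q - 1) (δ := 1 / 2) (by norm_num) (by norm_num)
      (le_zero_iff.1 (h0 ▸ powerIntegral_mono (p - q - 1) (by norm_num)))
  have hZ0 : Z ≠ 0 := mul_ne_zero (ENNReal.ofReal_pos.2 (by linarith)).ne'
    (by rw [Ne, ENNReal.rpow_eq_zero_iff_of_pos (by positivity)]; exact hz)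
  set R : ℝ≥0∞ := (C / Z) ^ p' with hR
  have hRt : R ≠ ∞ := ENNReal.rpow_ne_top_of_nonneg (by positivity)
    (ENNReal.div_ne_top ENNReal.coe_ne_top hZ0)
  have hbound : ∀ δ : ℝ, 0 < δ → δ < 1 → powerIntegral (p' - q - 1) δ ≤ R := by
    intro δ hδ hδ1
    have h1 := hC (p' - 2) δ hδ
    rw [e1, show 1 + (p' - 2) - q = p' - q - 1 by ring] at h1
    -- The cut-off makes `E` finite and nonzero, so a factor `E^(1/p)` can be cancelled, leaving
    -- `E^(1/p')`.
    set E := powerIntegral (p' - q - 1) δ with hE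
    have hE0 : E ≠ 0 := powerIntegral_ne_zero _ hδ hδ1
    have hEt : E ≠ ∞ := powerIntegral_ne_top _ hδ
    have hEp : E = E ^ (1 / p) * E ^ (1 / p') := by
      rw [← ENNReal.rpow_add _ _ hE0 hEt]
      have : 1 / p + 1 / p' = 1 := by
        rw [hp']
        field_simp
        ring
      rw [this, ENNReal.rpow_one]
    have hE1 : E ^ (1 / p) ≠ 0 := by
      rw [Ne, ENNReal.rpow_eq_zero_iff_of_pos (by positivity)]
      exact hE0
    have hE2 : E ^ (1 / p) ≠ ∞ := ENNReal.rpow_ne_top_of_nonneg (by positivity) hEt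
    have h2 : E ^ (1 / p') * Z ≤ C := by
      refine (ENNReal.mul_le_mul_iff_right hE1 hE2).1 ?_
      calc E ^ (1 / p) * (E ^ (1 / p') * Z) = (E ^ (1 / p) * E ^ (1 / p')) * Z := by ring
        _ = ENNReal.ofReal (2 - q) * E * powerIntegral (p - q - 1) 0 ^ (1 / p) := by
            rw [← hEp, hZ]
            ring
        _ ≤ _ := h1
        _ = _ := by ring
    have h3 : E ^ (1 / p') ≤ C / Z :=
      (ENNReal.le_div_iff_mul_le (Or.inl hZ0) (Or.inr ENNReal.coe_ne_top)).2 h2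
    have hp'0 : 0 < p' := by positivity
    calc E = (E ^ (1 / p')) ^ p' := by
          rw [← ENNReal.rpow_mul, one_div_mul_cancel hp'0.ne', ENNReal.rpow_one]
      _ ≤ R := ENNReal.rpow_le_rpow h3 hp'0.le
  -- With this cut-off the logarithmic lower bound is `R + 1`, exceeding the uniform bound `R`.
  have hδ1 : Real.exp (-(R.toReal + 1)) < 1 := by
    rw [Real.exp_lt_one_iff]
    linarith [R.toReal_nonneg]
  have h1 := (neg_log_le_powerIntegral (e := p' - q - 1) (by linarith) (Real.exp_pos _) hδ1).trans
    (hbound _ (Real.exp_pos _) hδ1)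
  rw [Real.log_exp, neg_neg, ENNReal.ofReal_le_iff_le_toReal hRt] at h1
  linarith

theorem bergmanProjectionLpBounded_iff {q p : ℝ} (hq1 : 1 ≤ q) (hq2 : q < 2) (hp : 1 ≤ p) :
    BergmanProjectionLpBounded hartogsTriangle (hartogsWeight (-(q + 4))) p ↔
      q < p ∧ p * q < p + q := by
  refine ⟨fun h => ?_, fun h => bergmanProjectionLpBounded_of_lt hq1 hq2 h.1 h.2⟩
  have h1 := lt_of_bergmanProjectionLpBounded hq1 hq2 (by linarith) h
  exact ⟨h1, mul_lt_add_of_bergmanProjectionLpBounded hq1 hq2 (by linarith) h⟩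

end Unbounded

/-! ### Conjugate exponents and the shrinking range. -/

section Corollary

theorem not_bddAbove_hartogsWeight {s : ℝ} (hs : s < 0) :
    ¬ BddAbove (hartogsWeight s '' hartogsTriangle) := by
  intro ⟨M, hM⟩
  have h1 : Tendsto (fun t : ℝ => t ^ s) (𝓝[>] 0) atTop := tendsto_rpow_neg_nhdsGT_zero hs
  have h2 : ∀ᶠ t : ℝ in 𝓝[>] 0, t ∈ Ioo (0 : ℝ) 1 := Ioo_mem_nhdsGT one_pos
  obtain ⟨t, ht1, ht2⟩ := ((h1.eventually_gt_atTop M).and h2).exists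
  have h3 : ‖(t : ℂ)‖ = t := by rw [Complex.norm_real, Real.norm_eq_abs, abs_of_pos ht2.1]
  have hmem : ((0 : ℂ), (t : ℂ)) ∈ hartogsTriangle := by
    refine ⟨?_, ?_⟩ <;> simp only [norm_zero, h3]
    exacts [ht2.1, ht2.2]
  have h4 := hM (mem_image_of_mem _ hmem)
  simp only [hartogsWeight, h3] at h4
  linarith

/-- Both sides say `1 - 1/q < 1/p`. Working with inverses in `ℝ≥0∞` includes `q = 1`, `q' = ∞`,
where both always hold. -/
theorem ofReal_lt_conjugate_iff {q p : ℝ} (hq : 1 ≤ q) (hp : 1 ≤ p) {q' : ℝ≥0∞}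
    (h : (ENNReal.ofReal q).HolderConjugate q') : ENNReal.ofReal p < q' ↔ p * q < p + q := by
  have hq0 : 0 < q := by linarith
  have hp0 : 0 < p := by linarith
  have h1 := ENNReal.HolderConjugate.inv_add_inv_eq_one (ENNReal.ofReal q) q'
  rw [← ENNReal.ofReal_inv_of_pos hq0] at h1
  have hqinv : q⁻¹ ≤ 1 := inv_le_one_of_one_le₀ hq
  have h2 : q'⁻¹ = ENNReal.ofReal (1 - q⁻¹) := by
    rw [ENNReal.ofReal_sub _ (by positivity), ENNReal.ofReal_one]
    exact ENNReal.eq_sub_of_add_eq' (by simp) (by rw [add_comm]; exact h1)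
  rw [← ENNReal.inv_lt_inv, h2, ← ENNReal.ofReal_inv_of_pos hp0,
    ENNReal.ofReal_lt_ofReal_iff (by positivity), sub_lt_iff_lt_add]
  rw [show p⁻¹ + q⁻¹ = (p + q) / (p * q) by field_simp; ring, lt_div_iff₀ (by positivity), one_mul]

theorem corollary1p2 :
    (∀ p₀ : ℝ, 1 ≤ p₀ → p₀ < 2 →
      ∀ p₀' : ℝ≥0∞, (ENNReal.ofReal p₀).HolderConjugate p₀' →
        ∀ p : ℝ, 1 ≤ p →
          (BergmanProjectionLpBounded hartogsTriangle (hartogsWeight (-(p₀ + 4))) p ↔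
            p₀ < p ∧ ENNReal.ofReal p < p₀')) ∧
    (∀ ε : ℝ, 0 < ε →
      ∃ s : ℝ, ¬ BddAbove (hartogsWeight s '' hartogsTriangle) ∧
        {p : ℝ | 1 ≤ p ∧ BergmanProjectionLpBounded hartogsTriangle (hartogsWeight s) p} ⊆
          Ioo (2 - ε) (2 + ε)) := by
  refine ⟨fun q hq1 hq2 q' hq' p hp => ?_, fun ε hε => ?_⟩
  · rw [ofReal_lt_conjugate_iff hq1 hp hq']
    exact bergmanProjectionLpBounded_iff hq1 hq2 hp
  -- For `q = 2 - d` the conjugate exponent is `2 + d / (1 - d)`. It is at most `2 + 2d` since `d ≤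
  -- 1/2`, hence at most `2 + ε`.
  · obtain ⟨d, hd0, hd1, hd2⟩ : ∃ d : ℝ, 0 < d ∧ d ≤ 1 / 2 ∧ d ≤ ε / 2 :=
      ⟨min (1 / 2) (ε / 2), by positivity, min_le_left _ _, min_le_right _ _⟩
    refine ⟨-((2 - d) + 4), not_bddAbove_hartogsWeight (by linarith), fun p hp => ?_⟩
    obtain ⟨hp1, hp2⟩ := hp
    obtain ⟨h1, h2⟩ := (bergmanProjectionLpBounded_iff (by linarith) (by linarith) hp1).1 hp2
    refine ⟨by linarith, ?_⟩
    nlinarith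

end Corollary
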